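/- Manifolds are smooth, Hausdorff and without boundary; $X$ and $Y$ below are finite-dimensional and second countable, and the other manifolds may be modelled on Banach spaces. For a map $p\colon W\to B$ let $W^{[n]}$ be the $n$-fold fibre product of $W$ over $B$, with face maps $d_i$ omitting the factor number $i$ (counted from $0$). For face maps $d_0,\dots,d_n$ put $\delta\omega=\sum_i(-1)^i d_i^*\omega$ on differential forms and $\delta E=\bigotimes_i d_i^*E^{(-1)^i}$ on principal $U(1)$-bundles, where $E^{-1}=E^*$; a section $s$ of $E$ induces a section $\delta(s)$ of $\delta E$, a connection $\nabla$ on $E$ induces a connection $\delta\nabla$ on $\delta E$, and $\delta^2E$ has a canonical section $1$. A *rigid bundle 2-gerbe* on $X$ consists of a surjective submersion $f\colon Y\to X$; a 3-truncated simplicial manifold $Z_\bullet$ with a simplicial map $\pi\colon Z_\bullet\to Y^{[\bullet+1]}$ that is a surjective submersion in each degree (write $Z_k^{[n]}$ for the fibre powers of $Z_k$ over $Y^{[k+1]}$, and $\delta_h$, $\delta_v$ for $\delta$ with respect to the face maps of $Z_\bullet$ and of the fibre powers respectively); a principal $U(1)$-bundle $E\to Z_1^{[2]}$; a smooth section $m$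 of $\delta_vE$ over $Z_1^{[3]}$ with $\delta_v(m)=1$ over $Z_1^{[4]}$; and a smooth section $M$ of $\delta_hE$ over $Z_2^{[2]}$ with $\delta_v(M)=\delta_h(m)$ over $Z_2^{[3]}$ and $\delta_h(M)=1$ over $Z_3^{[2]}$. A *rigid connective structure* on it is a tuple $(\nabla,\beta,\lambda,\alpha)$ of a connection $\nabla$ on $E$ (with $\mathfrak u(1)$ identified with $\mathbb R$) and smooth forms $\beta\in\Omega^2(Z_1)$, $\lambda\in\Omega^3(Y)$, $\alpha\in\Omega^1(Z_2)$ such that 1. $m^*(\delta_v\nabla)=0$; 2. $\delta_v\beta$ is the curvature of $\nabla$; 3. $\pi^*\delta_h\lambda=d\beta$, where $\delta_h\lambda\in\Omega^3(Y^{[2]})$ is formed with the face maps $Y^{[2]}\to Y$; 4. $\delta_v\alpha=M^*(\delta_h\nabla)$; 5. $d\alpha=\delta_h\beta$; 6. $\delta_h\alpha=0$. Its *4-curvature* is the smooth form $F\in\Omega^4(X)$ with $f^*F=d\lambda$. **Proposition.** Let $(\nabla,\beta,\lambda,\alpha)$ and $(\nabla',\beta',\lambda',\alpha')$ be rigid connective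 structures on the same rigid bundle 2-gerbe on $X$. Then their 4-curvatures $F$ and $F'$ exist, are unique and are closed, and $F-F'=d\eta$ for some $\eta\in\Omega^3(X)$. Hence $[F]=[F']$ in $H^4_{dR}(X)$: the de Rham class is an invariant of the rigid bundle 2-gerbe. -/

import Mathlib

open CategoryTheory Topology
open scoped Manifold ContDiff

universe u

noncomputable section

/-! ## Smooth manifolds -/

/-- A smooth Hausdorff manifold without boundary, modelled on a real Banach space. -/
structure SmoothMfd : Type (u + 1) where
  carrier : Type u
  model : Type u
  [normed : NormedAddCommGroup model]
  [space : NormedSpace ℝ model]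
  [complete : CompleteSpace model]
  [top : TopologicalSpace carrier]
  [t2 : T2Space carrier]
  [charted : ChartedSpace model carrier]
  [smooth : IsManifold 𝓘(ℝ, model) ∞ carrier]

namespace SmoothMfd

instance : CoeSort SmoothMfd.{u} (Type u) := ⟨SmoothMfd.carrier⟩

attribute [instance] normed space complete top t2 charted smooth

/-- `M` is finite-dimensional and second countable. -/
structure IsFiniteDim (M : SmoothMfd.{u}) : Prop where
  finiteDimensional : FiniteDimensional ℝ M.model
  secondCountable : SecondCountableTopology M

/-- Smooth maps. -/
abbrev IsSmooth {M N : SmoothMfd.{u}} (f : M → N) : Prop :=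
  ContMDiff 𝓘(ℝ, M.model) 𝓘(ℝ, N.model) ∞ f

/-- Maps that are smooth on a set. -/
abbrev IsSmoothOn {M N : SmoothMfd.{u}} (f : M → N) (s : Set M) : Prop :=
  ContMDiffOn 𝓘(ℝ, M.model) 𝓘(ℝ, N.model) ∞ f s

@[ext]
structure Hom (M N : SmoothMfd.{u}) : Type u where
  toFun : M → N
  isSmooth : IsSmooth toFun

/-- The category of smooth manifolds and smooth maps. -/
instance : Category.{u} SmoothMfd.{u} where
  Hom := Hom
  id _ := ⟨id, contMDiff_id⟩
  comp f g := ⟨g.toFun ∘ f.toFun, g.isSmooth.comp f.isSmooth⟩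

/-- The smooth map underlying a morphism. -/
def fn {M N : SmoothMfd.{u}} (f : M ⟶ N) : M → N := Hom.toFun f

/-- Surjective submersions. -/
structure IsSurjSubmersion {M N : SmoothMfd.{u}} (f : M → N) : Prop where
  surjective : Function.Surjective f
  submersion : ∀ x, Manifold.IsSubmersionAt 𝓘(ℝ, M.model) 𝓘(ℝ, N.model) ∞ f x

end SmoothMfd

open SmoothMfd

/-! ## Differential forms -/

section Forms

/-- A (not necessarily smooth) differential `k`-form on `M`. -/
def RawForm (M : SmoothMfd.{u}) (k : ℕ) : Type u :=
  ∀ x : M, TangentSpace 𝓘(ℝ, M.model) x [⋀^Fin k]→L[ℝ] ℝ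

instance (M : SmoothMfd.{u}) (k : ℕ) : AddCommGroup (RawForm M k) :=
  inferInstanceAs (AddCommGroup (∀ x : M, TangentSpace 𝓘(ℝ, M.model) x [⋀^Fin k]→L[ℝ] ℝ))

instance (M : SmoothMfd.{u}) (k : ℕ) : Module ℝ (RawForm M k) :=
  inferInstanceAs (Module ℝ (∀ x : M, TangentSpace 𝓘(ℝ, M.model) x [⋀^Fin k]→L[ℝ] ℝ))

namespace RawForm

variable {M N : SmoothMfd.{u}} {k : ℕ}

/-- The pullback `f^*w`. -/
def pullback (f : M → N) (w : RawForm N k) : RawForm M k := fun x =>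
  (w (f x)).compContinuousLinearMap (mfderiv 𝓘(ℝ, M.model) 𝓘(ℝ, N.model) f x)

/-- The expression of `w` in the preferred chart at `x`: the pullback of `w` along the inverse of
that chart. It is meaningful on the target of the chart. -/
def inChart (w : RawForm M k) (x : M) (v : M.model) : M.model [⋀^Fin k]→L[ℝ] ℝ :=
  (w ((extChartAt 𝓘(ℝ, M.model) x).symm v)).compContinuousLinearMap
    (mfderiv 𝓘(ℝ, M.model) 𝓘(ℝ, M.model) (extChartAt 𝓘(ℝ, M.model) x).symm v)

/-- A form is smooth if its expressions in charts are smooth. -/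
def Smooth (w : RawForm M k) : Prop :=
  ∀ x : M, ContDiffOn ℝ ∞ (w.inChart x) (extChartAt 𝓘(ℝ, M.model) x).target

/-- The exterior derivative, computed at `x` in the preferred chart at `x`. -/
def d (w : RawForm M k) : RawForm M (k + 1) := fun x =>
  (extDeriv (w.inChart x) (extChartAt 𝓘(ℝ, M.model) x x)).compContinuousLinearMap
    (mfderiv 𝓘(ℝ, M.model) 𝓘(ℝ, M.model) (extChartAt 𝓘(ℝ, M.model) x) x)

lemma inChart_add (w η : RawForm M k) (x : M) :
    (w + η).inChart x = w.inChart x + η.inChart x := rfl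

lemma inChart_smul (c : ℝ) (w : RawForm M k) (x : M) :
    (c • w).inChart x = c • w.inChart x := rfl

lemma Smooth.differentiableAt {w : RawForm M k} (h : w.Smooth) (x : M) :
    DifferentiableAt ℝ (w.inChart x) (extChartAt 𝓘(ℝ, M.model) x x) :=
  ((h x).contDiffAt ((isOpen_extChartAt_target x).mem_nhds
    (mem_extChartAt_target x))).differentiableAt (by simp)

end RawForm

open RawForm

variable (M : SmoothMfd.{u}) (k : ℕ)

/-- The space `Ω^k(M)` of smooth `k`-forms. -/
def smoothForms : Submodule ℝ (RawForm M k) where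
  carrier := {w | w.Smooth}
  add_mem' {w η} hw hη x := (hw x).add (hη x)
  zero_mem' x := by
    have : (0 : RawForm M k).inChart x = fun _ => 0 := rfl
    rw [this]
    exact contDiffOn_const
  smul_mem' c w hw x := (hw x).const_smul c

/-- The exterior derivative as a linear map on `Ω^k(M)`. -/
def dLin : smoothForms M k →ₗ[ℝ] RawForm M (k + 1) where
  toFun w := d (w : RawForm M k)
  map_add' w η := by
    funext x
    have := extDeriv_add (Smooth.differentiableAt w.2 x) (Smooth.differentiableAt η.2 x)
    simp only [d, Submodule.coe_add, inChart_add]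
    rw [this]
    rfl
  map_smul' c w := by
    funext x
    simp only [d, Submodule.coe_smul, inChart_smul, RingHom.id_apply]
    rw [extDeriv_smul]
    rfl

/-- Closed smooth `k`-forms. -/
def closedForms : Submodule ℝ (RawForm M k) :=
  (LinearMap.ker (dLin M k)).map (smoothForms M k).subtype

/-- Exact `(k+1)`-forms `dη`, with `η` a smooth `k`-form. -/
def exactForms : Submodule ℝ (RawForm M (k + 1)) := LinearMap.range (dLin M k)

/-- The de Rham cohomology `H^{k+1}_{dR}(M)`: closed forms modulo exact forms. -/
abbrev DeRham : Type u :=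
  closedForms M (k + 1) ⧸ (exactForms M k).comap (closedForms M (k + 1)).subtype

variable {M k}

/-- The de Rham class of a closed form. -/
def deRhamClass (w : RawForm M (k + 1)) (hw : w ∈ closedForms M (k + 1)) : DeRham M k :=
  Submodule.Quotient.mk ⟨w, hw⟩

/-- The alternating sum `δw = ∑ (-1)^i d_i^*w` of the pullbacks along `n` maps. -/
def delta {M N : SmoothMfd.{u}} {k n : ℕ} (face : Fin n → M → N) (w : RawForm N k) :
    RawForm M k :=
  ∑ i : Fin n, (-1 : ℝ) ^ (i : ℕ) • pullback (face i) w

end Forms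

/-! ## Fibre powers -/

section FibrePower

/-- The `n`-fold fibre product of `M` with itself over `N`, as a subspace of `M^n`. -/
abbrev FibrePower {M N : SmoothMfd.{u}} (f : M → N) (n : ℕ) : Type u :=
  {y : Fin n → M // ∀ i j, f (y i) = f (y j)}

/-- The smooth structure of the `n`-fold fibre product: a smooth structure on the subspace
`FibrePower f n` of `M^n` for which the projections to `M` are smooth, and for which a map into it
is smooth as soon as its components are. There is at most one such structure. For a submersion onto a
finite-dimensional manifold there is one: that of a submanifold of `M^n`. -/
structure FibrePowerStr {M N : SmoothMfd.{u}} (f : M → N) (n : ℕ) : Type (u + 1) where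
  model : Type u
  [normed : NormedAddCommGroup model]
  [space : NormedSpace ℝ model]
  [complete : CompleteSpace model]
  [charted : ChartedSpace model (FibrePower f n)]
  [smooth : IsManifold 𝓘(ℝ, model) ∞ (FibrePower f n)]
  smooth_proj : ∀ i, ContMDiff 𝓘(ℝ, model) 𝓘(ℝ, M.model) ∞ fun y : FibrePower f n => y.1 i
  smooth_of_components : ∀ (L : SmoothMfd.{u}) (s : Set L) (g : L → FibrePower f n), IsOpen s →
    (∀ i, ContMDiffOn 𝓘(ℝ, L.model) 𝓘(ℝ, M.model) ∞ (fun x => (g x).1 i) s) →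
    ContMDiffOn 𝓘(ℝ, L.model) 𝓘(ℝ, model) ∞ g s

namespace FibrePowerStr

attribute [instance] normed space complete charted smooth

variable {M N M' N' : SmoothMfd.{u}} {f : M → N} {f' : M' → N'} {n m : ℕ}

/-- The `n`-fold fibre product as a smooth manifold. -/
abbrev mfd (P : FibrePowerStr f n) : SmoothMfd.{u} where
  carrier := FibrePower f n
  model := P.model

/-- Reindexing the factors of a fibre product. -/
def reindex (P : FibrePowerStr f n) (Q : FibrePowerStr f m) (θ : Fin m → Fin n) : P.mfd ⟶ Q.mfd :=
  ⟨fun y => ⟨fun i => y.1 (θ i), fun i j => y.2 (θ i) (θ j)⟩, by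
    rw [IsSmooth, ← contMDiffOn_univ]
    exact Q.smooth_of_components P.mfd _ _ isOpen_univ
      fun i => (P.smooth_proj (θ i)).contMDiffOn⟩

end FibrePowerStr

variable {M N M' N' : SmoothMfd.{u}} {f : M → N} {f' : M' → N'} {n : ℕ}

/-- The face map that omits the factor number `i` (counted from `0`). -/
def dropFace (i : Fin (n + 1)) (y : FibrePower f (n + 1)) : FibrePower f n :=
  ⟨fun j => y.1 (i.succAbove j), fun _ _ => y.2 _ _⟩

/-- The face maps from the two-fold fibre product to `M` itself; number `i` omits the factor
number `i`. -/
def dropFace₂ (i : Fin 2) (y : FibrePower f 2) : M := y.1 (i.succAbove 0)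

/-- The map of `n`-fold fibre products induced by a commutative square. -/
def FibrePower.map (g : M → M') (h : N → N') (comm : ∀ y, f' (g y) = h (f y))
    (y : FibrePower f n) : FibrePower f' n :=
  ⟨fun i => g (y.1 i), fun i j => by rw [comm, comm, y.2 i j]⟩

/-- The Čech nerve `Y^{[•+1]}` of `f : Y → X`; its face map `d_i` omits the factor number `i`. -/
def cechNerve (P : ∀ n : ℕ, FibrePowerStr f (n + 1)) : SimplicialObject SmoothMfd.{u} where
  obj a := (P a.unop.len).mfd
  map θ := (P _).reindex (P _) θ.unop.toOrderHom

end FibrePower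

/-! ## Principal `U(1)`-bundles, their tensor products and connections -/

/-- A smooth principal `U(1)`-bundle on `B`. -/
structure CircleBundle (B : SmoothMfd.{u}) : Type (u + 1) where
  total : SmoothMfd.{u}
  proj : total → B
  [action : MulAction Circle total]
  proj_smul : ∀ (z : Circle) (e : total), proj (z • e) = proj e
  /-- Smooth equivariant local trivialisations. -/
  locally_trivial : ∀ b : B, ∃ t : Bundle.Trivialization Circle proj,
    b ∈ t.baseSet ∧
    ContMDiffOn 𝓘(ℝ, total.model) (𝓘(ℝ, B.model).prod (𝓡 1)) ∞ t t.source ∧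
    ContMDiffOn (𝓘(ℝ, B.model).prod (𝓡 1)) 𝓘(ℝ, total.model) ∞
      t.toOpenPartialHomeomorph.symm t.target ∧
    ∀ (z : Circle), ∀ e ∈ t.source, t (z • e) = ((t e).1, z * (t e).2)

namespace CircleBundle

attribute [instance] action

variable {B C D : SmoothMfd.{u}} (E : CircleBundle B) {ι : Type} [Fintype ι]

/-- A family `e` of points of `E`, lying over points `b i`, represents an element `⊗ (e i)^{ε i}`
of the fibre of the `U(1)`-bundle `⊗ (E_{b i})^{ε i}`, where `ε i = ±1` and `E^{-1} = E^*`. This is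
the set of all families that represent the same element as `e`. Elements of tensor products are
represented by these sets. -/
def tensor (ε : ι → ℤ) (e : ι → E.total) : Set (ι → E.total) :=
  {e' | ∃ z : ι → Circle, ∏ i, z i ^ ε i = 1 ∧ ∀ i, e' i = z i • e i}

/-- The family `σ` of maps, smooth on the open set `U ⊆ C` and lying over the maps `p i`, represents
the section `s` of `⊗ (p i)^*E^{ε i}` on `U`. -/
structure Represents (p : ι → C → B) (ε : ι → ℤ) (s : C → Set (ι → E.total)) (U : Set C)
    (σ : ι → C → E.total) : Prop where
  isOpen : IsOpen U
  smooth : ∀ i, IsSmoothOn (σ i) U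
  lies_over : ∀ c ∈ U, ∀ i, E.proj (σ i c) = p i c
  eq_tensor : ∀ c ∈ U, s c = E.tensor ε fun i => σ i c

/-- `s` is a smooth section of the `U(1)`-bundle `⊗ (p i)^*E^{ε i}` on `C`. -/
def IsSection (p : ι → C → B) (ε : ι → ℤ) (s : C → Set (ι → E.total)) : Prop :=
  ∀ c, ∃ U σ, c ∈ U ∧ E.Represents p ε s U σ

/-- The alternating signs of `δ`. -/
def sign₁ {n : ℕ} (i : Fin n) : ℤ := (-1) ^ (i : ℕ)

/-- The signs of a twofold application of `δ`. -/
def sign₂ {n m : ℕ} (i : Fin n × Fin m) : ℤ := (-1) ^ (i.1 : ℕ) * (-1) ^ (i.2 : ℕ)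

variable {E}

/-- If `s` is a section of `δE = ⊗ (p j)^*E^{(-1)^j}` on `C` and `q i : D → C` are maps, the induced
section `δ(s) = ⊗ (q i)^*s^{(-1)^i}` of `δδE` on `D`. -/
def deltaSection {n m : ℕ} (q : Fin n → D → C) (s : C → Set (Fin m → E.total)) (y : D) :
    Set (Fin n × Fin m → E.total) :=
  {e | ∃ e' : Fin n × Fin m → E.total,
    (∀ i, (fun j => e' (i, j)) ∈ s (q i y)) ∧ e ∈ E.tensor sign₂ e'}

variable (E)

/-- The canonical section `1` of `δδE`, for face maps `p : C → B` and `q : D → C` that satisfy the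
simplicial identities `p_j q_i = p_i q_{j+1}` for `i ≤ j`. The factors of `δδE` with the indices
`(i, j)` and `(j + 1, i)` are the same bundle with opposite signs, and they are contracted. -/
def canonicalSection {n : ℕ} (p : Fin (n + 1) → C → B) (q : Fin (n + 2) → D → C) (y : D) :
    Set (Fin (n + 2) × Fin (n + 1) → E.total) :=
  {e | ∃ e' : Fin (n + 2) × Fin (n + 1) → E.total,
    (∀ i j, E.proj (e' (i, j)) = p j (q i y)) ∧
    (∀ i j : Fin (n + 1), i ≤ j → e' (i.castSucc, j) = e' (j.succ, i)) ∧
    e ∈ E.tensor sign₂ e'}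

/-- A connection on `E`, with the Lie algebra of `U(1)` identified with `ℝ` through
`t ↦ exp (i t)`. -/
structure IsConnection (A : RawForm E.total 1) : Prop where
  smooth : A.Smooth
  invariant : ∀ z : Circle, RawForm.pullback (fun e : E.total => z • e) A = A
  vertical : ∀ e : E.total, A (Circle.exp 0 • e) (fun _ =>
    mfderiv 𝓘(ℝ, ℝ) 𝓘(ℝ, E.total.model) (fun t : ℝ => Circle.exp t • e) 0 (1 : ℝ)) = 1

/-- `F` is the curvature of the connection `A`: its pullback to the total space is `dA`. -/
def IsCurvature (A : RawForm E.total 1) (F : RawForm B 2) : Prop :=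
  F.Smooth ∧ RawForm.pullback E.proj F = A.d

/-- `η = s^*(δA)`, where `s` is a section of `δE = ⊗ (p i)^*E^{(-1)^i}` and `δA` is the connection
on `δE` induced by `A`: wherever `s` is represented by `σ`, the form is `∑ (-1)^i (σ i)^*A`. -/
def IsPullbackConnection {n : ℕ} (p : Fin n → C → B) (s : C → Set (Fin n → E.total))
    (A : RawForm E.total 1) (η : RawForm C 1) : Prop :=
  ∀ U σ, E.Represents p sign₁ s U σ → ∀ c ∈ U, η c = delta σ A c

end CircleBundle

/-! ## Rigid bundle 2-gerbes -/

/-- The object `[n]` of the 3-truncated simplex category. -/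
abbrev simplex (n : Fin 4) : SimplexCategory.Truncated 3 :=
  ⟨SimplexCategory.mk n, by have := n.2; change (n : ℕ) ≤ 3; omega⟩

/-- The surjective submersions that underlie a rigid bundle 2-gerbe on `X`: a surjective submersion
`f : Y → X` and a surjective submersion `Z_• → Y^{[•+1]}` of 3-truncated simplicial manifolds, with
the smooth structures of the fibre products `Y^{[n+1]}` and `Z_k^{[n+1]} = Z_k ×_{Y^{[k+1]}} ⋯`. -/
structure RigidSubmersion (X : SmoothMfd.{u}) : Type (u + 1) where
  Y : SmoothMfd.{u}
  Y_finiteDim : Y.IsFiniteDim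
  f : Y → X
  f_submersion : IsSurjSubmersion f
  Ypow : ∀ n : ℕ, FibrePowerStr f (n + 1)
  Z : SimplicialObject.Truncated SmoothMfd.{u} 3
  π : Z ⟶ (SimplicialObject.truncation 3).obj (cechNerve Ypow)
  π_submersion : ∀ a, IsSurjSubmersion (fn (π.app a))
  Zpow : ∀ (k : Fin 4) (n : ℕ), FibrePowerStr (fn (π.app (.op (simplex k)))) (n + 1)

namespace RigidSubmersion

variable {X : SmoothMfd.{u}} (S : RigidSubmersion X)

/-- The manifold `Z_k`. -/
abbrev Zm (k : Fin 4) : SmoothMfd.{u} := S.Z.obj (.op (simplex k))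

/-- The projection `Z_k → Y^{[k+1]}`. -/
def πm (k : Fin 4) : S.Zm k → (S.Ypow k).mfd := fn (S.π.app (.op (simplex k)))

/-- The face maps `Z_{k+1} → Z_k`. -/
def face (k : Fin 3) (i : Fin (k + 2)) : S.Zm k.succ → S.Zm k.castSucc :=
  fn (S.Z.map (Quiver.Hom.op
    (SimplexCategory.Truncated.Hom.tr (SimplexCategory.δ (n := (k : ℕ)) i)
      (simplex k.castSucc).property (simplex k.succ).property)))

/-- The manifold `Z_k^{[n+1]}`. -/
abbrev Zp (k : Fin 4) (n : ℕ) : SmoothMfd.{u} := (S.Zpow k n).mfd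

lemma face_comm (k : Fin 3) (i : Fin (k + 2)) (z : S.Zm k.succ) :
    fn (S.π.app (.op (simplex k.castSucc))) (S.face k i z) =
      fn ((cechNerve S.Ypow).map (SimplexCategory.δ (n := (k : ℕ)) i).op)
        (fn (S.π.app (.op (simplex k.succ))) z) :=
  congrFun (congrArg Hom.toFun (S.π.naturality (Quiver.Hom.op
    (SimplexCategory.Truncated.Hom.tr (SimplexCategory.δ (n := (k : ℕ)) i)
      (simplex k.castSucc).property (simplex k.succ).property)))) z

/-- The horizontal face maps `Z_{k+1}^{[n+1]} → Z_k^{[n+1]}`. -/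
def faceH (k : Fin 3) (n : ℕ) (i : Fin (k + 2)) : S.Zp k.succ n → S.Zp k.castSucc n :=
  FibrePower.map (S.face k i) _ (S.face_comm k i)

/-- The vertical face maps `Z_k^{[n+2]} → Z_k^{[n+1]}`. -/
def faceV (k : Fin 4) (n : ℕ) (i : Fin (n + 2)) : S.Zp k (n + 1) → S.Zp k n := dropFace i

/-- The vertical face maps `Z_k^{[2]} → Z_k`. -/
def faceV₀ (k : Fin 4) (i : Fin 2) : S.Zp k 1 → S.Zm k := dropFace₂ i

/-- The face maps `Y^{[2]} → Y`. -/
def faceY (i : Fin 2) : (S.Ypow 1).mfd → S.Y := dropFace₂ i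

end RigidSubmersion

open CircleBundle

/-- A rigid bundle 2-gerbe on `X`. -/
structure RigidBundle2Gerbe (X : SmoothMfd.{u}) : Type (u + 1) extends RigidSubmersion X where
  /-- The `U(1)`-bundle on `Z_1^{[2]}`. -/
  E : CircleBundle (toRigidSubmersion.Zp 1 1)
  /-- The bundle gerbe multiplication, a section of `δ_v E` on `Z_1^{[3]}`. -/
  m : toRigidSubmersion.Zp 1 2 → Set (Fin 3 → E.total)
  m_section : E.IsSection (toRigidSubmersion.faceV 1 1) sign₁ m
  /-- Associativity of the bundle gerbe multiplication: `δ_v(m) = 1` on `Z_1^{[4]}`. -/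
  m_assoc : ∀ y : toRigidSubmersion.Zp 1 3,
    deltaSection (toRigidSubmersion.faceV 1 2) m y =
      E.canonicalSection (toRigidSubmersion.faceV 1 1) (toRigidSubmersion.faceV 1 2) y
  /-- The bundle 2-gerbe multiplication, a section of `δ_h E` on `Z_2^{[2]}`. -/
  mult : toRigidSubmersion.Zp 2 1 → Set (Fin 3 → E.total)
  mult_section : E.IsSection (toRigidSubmersion.faceH 1 1) sign₁ mult
  /-- `δ_v(M) = δ_h(m)` on `Z_2^{[3]}`, up to the isomorphism `δ_v δ_h E ≃ δ_h δ_v E` which permutes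
  the factors. -/
  mult_compat : ∀ y : toRigidSubmersion.Zp 2 2,
    {e | (fun ij => e (ij.2, ij.1)) ∈ deltaSection (toRigidSubmersion.faceV 2 1) mult y} =
      deltaSection (toRigidSubmersion.faceH 1 2) m y
  /-- `δ_h(M) = 1` on `Z_3^{[2]}`. -/
  mult_assoc : ∀ y : toRigidSubmersion.Zp 3 1,
    deltaSection (toRigidSubmersion.faceH 2 1) mult y =
      E.canonicalSection (toRigidSubmersion.faceH 1 1) (toRigidSubmersion.faceH 2 1) y

/-! ## Connective structures -/

/-- A connective structure `(∇, β, λ)` on a rigid bundle 2-gerbe. -/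
structure ConnectiveStructure {X : SmoothMfd.{u}} (G : RigidBundle2Gerbe X) : Type u where
  /-- The connection on `E`. -/
  conn : RawForm G.E.total 1
  /-- The curving, a 2-form on `Z_1`. -/
  β : RawForm (G.Zm 1) 2
  /-- The 2-curving, a 3-form on `Y`. -/
  lam : RawForm G.Y 3
  β_smooth : β.Smooth
  lam_smooth : lam.Smooth
  conn_connection : G.E.IsConnection conn
  /-- `∇` is a bundle gerbe connection: `m^*(δ_v ∇) = 0`. -/
  conn_gerbe : G.E.IsPullbackConnection (G.faceV 1 1) G.m conn 0
  /-- `δ_v β` is the curvature of `∇`. -/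
  curving : G.E.IsCurvature conn (delta (G.faceV₀ 1) β)
  /-- `π^* δ_h λ = dβ`. -/
  two_curving : RawForm.pullback (G.πm 1) (delta G.faceY lam) = β.d

/-- A rigid connective structure `(∇, β, λ, α)` on a rigid bundle 2-gerbe. -/
structure RigidConnectiveStructure {X : SmoothMfd.{u}} (G : RigidBundle2Gerbe X) : Type u
    extends ConnectiveStructure G where
  /-- A 1-form on `Z_2`. -/
  α : RawForm (G.Zm 2) 1
  α_smooth : α.Smooth
  /-- `δ_v α = M^*(δ_h ∇)`. -/
  α_vertical : G.E.IsPullbackConnection (G.faceH 1 1) G.mult conn (delta (G.faceV₀ 2) α)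
  /-- `dα = δ_h β`. -/
  α_d : α.d = delta (G.face 1) β
  /-- `δ_h α = 0`. -/
  α_horizontal : delta (G.face 2) α = 0

/-- `F` is the 4-curvature of a connective structure: the smooth 4-form on `X` with `f^*F = dλ`. -/
def ConnectiveStructure.IsFourCurvature {X : SmoothMfd.{u}} {G : RigidBundle2Gerbe X}
    (C : ConnectiveStructure G) (F : RawForm X 4) : Prop :=
  F.Smooth ∧ RawForm.pullback G.f F = C.lam.d

end

/-!
Write `(∇, β, λ, α)` and `(∇', β', λ', α')` for the two connective structures. Forms on the source of
a surjective submersion are compared with forms on its target by local sections, so that pullback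
along it is injective (`HasLocalSections.pullback_injective`); the form `dλ` descends to `X`, because
`δ(dλ)` becomes `ddβ = 0` on `Z_1`. This gives existence, uniqueness and closedness of the
4-curvatures.

For the comparison one needs that the complexes of forms on the fibre powers of a submersion are
exact. A local section prepends a point to a tuple of points of a fibre, which is an extra degeneracy
of the fibre powers over an open set of the base; a partition of unity on the base glues the
resulting contractions (`exists_delta_eq`). For this the base has to be `X` or `Y^{[2]}`, and the
latter inherits partitions of unity from `Y × Y`, in which it is closed
(`FibrePowerStr.admitsPartitions`).

The difference `∇' - ∇` is invariant and kills vertical vectors, so it descends to a 1-form `a` on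
`Z_1^{[2]}` (`CircleBundle.IsBasic.exists_pullback_eq`), and the compatibility with the
multiplications says that `δ_v a = 0` and `δ_v (α' - α) = δ_h a`. The first equation gives
`a = δ_v b`, and by the second one `α' - α - δ_h b` comes from a `δ`-closed form on `Y^{[3]}`, which
is `δκ` for some `κ` on `Y^{[2]}`. After adding the pullback of `κ` to `b`, one has `a = δ_v b` and
`α' - α = δ_h b` (`RigidConnectiveStructure.exists_primitive`). Now `β' - β - db` is killed by `δ_v`
and by `δ_h`, so it comes from a `δ`-closed form on `Y^{[2]}`, which is `δμ` for some 2-form `μ` on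
`Y`. Finally `λ' - λ - dμ` is killed by `δ` and descends to a 3-form `η` on `X` with `F' - F = dη`.
-/

open SmoothMfd RawForm CircleBundle

noncomputable section

/-! ### Pullback of alternating maps depends smoothly on the data -/

section AlternatingMaps

variable {E F G : Type*} [NormedAddCommGroup E] [NormedSpace ℝ E] [NormedAddCommGroup F]
  [NormedSpace ℝ F] [NormedAddCommGroup G] [NormedSpace ℝ G]

/-- A map into alternating forms is smooth if it is smooth as a map into multilinear forms:
antisymmetrisation is, up to the factor `k!`, a continuous left inverse of the inclusion. -/
lemma ContDiffAt.of_toContinuousMultilinearMap {k : ℕ} {n : WithTop ℕ∞}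
    {f : E → F [⋀^Fin k]→L[ℝ] ℝ} {x : E}
    (h : ContDiffAt ℝ n (fun y => (f y).toContinuousMultilinearMap) x) : ContDiffAt ℝ n f x := by
  let A : ContinuousMultilinearMap ℝ (fun _ : Fin k => F) ℝ →ₗ[ℝ] F [⋀^Fin k]→L[ℝ] ℝ :=
    { toFun := fun m => ContinuousMultilinearMap.alternatization m
      map_add' := fun _ _ => map_add _ _ _
      map_smul' := fun c m => by
        ext v
        simp only [ContinuousMultilinearMap.alternatization_apply_apply,
          _root_.smul_apply, ContinuousAlternatingMap.smul_apply,
          RingHom.id_apply, Finset.smul_sum]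
        exact Finset.sum_congr rfl fun σ _ => smul_comm _ _ _ }
  let A' := A.mkContinuous (k.factorial : ℝ) fun m => by
    refine ContinuousAlternatingMap.opNorm_le_bound _ (by positivity) fun v => ?_
    change ‖ContinuousMultilinearMap.alternatization m v‖ ≤ _
    rw [ContinuousMultilinearMap.alternatization_apply_apply]
    refine (norm_sum_le _ _).trans ?_
    have : ∀ σ ∈ (Finset.univ : Finset (Equiv.Perm (Fin k))),
        ‖Equiv.Perm.sign σ • m (v ∘ σ)‖ ≤ ‖m‖ * ∏ i, ‖v i‖ := by
      intro σ _
      have h1 : ‖Equiv.Perm.sign σ • m (v ∘ σ)‖ = ‖m (v ∘ σ)‖ := by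
        rcases Int.units_eq_one_or (Equiv.Perm.sign σ) with h | h <;> simp [h]
      rw [h1]
      refine (m.le_opNorm _).trans_eq ?_
      congr 1
      exact Equiv.prod_comp σ fun i => ‖v i‖
    refine (Finset.sum_le_sum this).trans_eq ?_
    simp [Fintype.card_perm, mul_assoc]
  have hA : f = fun y => ((k.factorial : ℝ)⁻¹) • A' (f y).toContinuousMultilinearMap := by
    funext y
    ext v
    have hk : (k.factorial : ℝ) ≠ 0 := by positivity
    change f y v = (k.factorial : ℝ)⁻¹ •
      ContinuousMultilinearMap.alternatization (f y).toContinuousMultilinearMap v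
    rw [ContinuousMultilinearMap.alternatization_apply_apply]
    have : ∀ σ ∈ (Finset.univ : Finset (Equiv.Perm (Fin k))),
        Equiv.Perm.sign σ • (f y).toContinuousMultilinearMap (v ∘ σ) = f y v := by
      intro σ _
      change Equiv.Perm.sign σ • (f y) (v ∘ σ) = f y v
      have := (f y).toAlternatingMap.map_perm v σ
      change f y (v ∘ σ) = _ • f y v at this
      rw [this, smul_smul]
      simp
    rw [Finset.sum_congr rfl this]
    simp [Fintype.card_perm, hk]
  rw [hA]
  exact (A'.contDiff.contDiffAt.comp x h).const_smul _

/-- The pullback of a smoothly varying alternating form along a smoothly varying linear map varies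
smoothly. -/
lemma ContDiffAt.compContinuousLinearMap {k : ℕ} {n : WithTop ℕ∞}
    {f : E → F [⋀^Fin k]→L[ℝ] ℝ} {g : E → G →L[ℝ] F} {x : E}
    (hf : ContDiffAt ℝ n f x) (hg : ContDiffAt ℝ n g x) :
    ContDiffAt ℝ n (fun y => (f y).compContinuousLinearMap (g y)) x := by
  refine ContDiffAt.of_toContinuousMultilinearMap ?_
  have h1 : ContDiffAt ℝ n (fun y =>
      ContinuousMultilinearMap.compContinuousLinearMapContinuousMultilinear ℝ
        (fun _ : Fin k => G) (fun _ => F) ℝ (fun _ => g y)) x :=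
    (ContinuousMultilinearMap.contDiff _).contDiffAt.comp x (contDiffAt_pi.2 fun _ => hg)
  let T : F [⋀^Fin k]→L[ℝ] ℝ →L[ℝ] ContinuousMultilinearMap ℝ (fun _ : Fin k => F) ℝ :=
    ContinuousAlternatingMap.toContinuousMultilinearMapCLM ℝ
  have h2 : ContDiffAt ℝ n (fun y => (f y).toContinuousMultilinearMap) x :=
    T.contDiff.contDiffAt.comp x hf
  exact h1.clm_apply h2

/-- The exterior derivative of a smooth form on a normed space is smooth. -/
lemma ContDiffAt.extDeriv {k : ℕ} {w : E → E [⋀^Fin k]→L[ℝ] ℝ} {x : E}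
    (h : ContDiffAt ℝ ∞ w x) : ContDiffAt ℝ ∞ (_root_.extDeriv w) x :=
  (ContinuousAlternatingMap.alternatizeUncurryFinCLM ℝ E ℝ).contDiff.contDiffAt.comp x
    (h.fderiv_right (by simp))

end AlternatingMaps

/-! ### Pullback, smoothness and the exterior derivative of forms on manifolds -/

namespace SmoothMfd

/-- A Banach space as a manifold. -/
abbrev ofModel (E : Type u) [NormedAddCommGroup E] [NormedSpace ℝ E] [CompleteSpace E] :
    SmoothMfd.{u} where
  carrier := E
  model := E

/-- A form on a Banach space as a function with values in alternating forms. -/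
abbrev onModel {E : Type u} [NormedAddCommGroup E] [NormedSpace ℝ E] [CompleteSpace E] {k : ℕ}
    (w : RawForm (ofModel E) k) : E → E [⋀^Fin k]→L[ℝ] ℝ := w

/-- Smoothness of a map at a point. -/
abbrev IsSmoothAt {M N : SmoothMfd.{u}} (f : M → N) (x : M) : Prop :=
  ContMDiffAt 𝓘(ℝ, M.model) 𝓘(ℝ, N.model) ∞ f x

/-- The preferred chart at `x`, as a map to the model. -/
abbrev chart (M : SmoothMfd.{u}) (x : M) : M → ofModel M.model := extChartAt 𝓘(ℝ, M.model) x

/-- The inverse of the preferred chart at `x`. -/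
abbrev chartInv (M : SmoothMfd.{u}) (x : M) : ofModel M.model → M :=
  (extChartAt 𝓘(ℝ, M.model) x).symm

variable {M N L : SmoothMfd.{u}}

lemma IsSmoothAt.mdiff {f : M → N} {x : M} (h : IsSmoothAt f x) :
    MDifferentiableAt 𝓘(ℝ, M.model) 𝓘(ℝ, N.model) f x :=
  ContMDiffAt.mdifferentiableAt h (by simp)

lemma IsSmoothAt.eventually_mdiff {f : M → N} {x : M} (h : IsSmoothAt f x) :
    ∀ᶠ y in 𝓝 x, MDifferentiableAt 𝓘(ℝ, M.model) 𝓘(ℝ, N.model) f y := by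
  have : IsManifold 𝓘(ℝ, M.model) 1 M := IsManifold.of_le (n := ∞) (by simp)
  have : IsManifold 𝓘(ℝ, N.model) 1 N := IsManifold.of_le (n := ∞) (by simp)
  have h1 : ContMDiffAt 𝓘(ℝ, M.model) 𝓘(ℝ, N.model) 1 f x := ContMDiffAt.of_le h (by simp)
  filter_upwards [(contMDiffAt_iff_contMDiffAt_nhds (by simp)).1 h1] with y hy
  exact hy.mdifferentiableAt (by simp)

lemma chartInv_chart (x : M) : chartInv M x (extChartAt 𝓘(ℝ, M.model) x x) = x :=
  extChartAt_to_inv x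

lemma isSmoothAt_chart {x y : M} (hy : y ∈ (extChartAt 𝓘(ℝ, M.model) x).source) :
    IsSmoothAt (chart M x) y :=
  contMDiffAt_extChartAt' (by simpa using hy)

lemma isSmoothAt_chartInv {x : M} {v : M.model} (hv : v ∈ (extChartAt 𝓘(ℝ, M.model) x).target) :
    IsSmoothAt (chartInv M x) v :=
  (contMDiffOn_extChartAt_symm x).contMDiffAt ((isOpen_extChartAt_target x).mem_nhds hv)

end SmoothMfd

namespace RawForm

variable {M N L : SmoothMfd.{u}} {k : ℕ}

lemma pullback_congr {f g : M → N} {x : M} (w : RawForm N k) (h : f =ᶠ[𝓝 x] g) :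
    pullback f w x = pullback g w x := by
  -- the tangent spaces at `f x` and `g x` are both the model space
  have key : ∀ (a b : N) (A B : M.model →L[ℝ] N.model), a = b → A = B →
      (show N.model [⋀^Fin k]→L[ℝ] ℝ from w a).compContinuousLinearMap A =
        (show N.model [⋀^Fin k]→L[ℝ] ℝ from w b).compContinuousLinearMap B := by
    rintro a _ A _ rfl rfl; rfl
  exact key _ _ _ _ h.eq_of_nhds h.mfderiv_eq

lemma pullback_comp_apply {f : M → N} {g : N → L} {x : M} (w : RawForm L k)
    (hg : MDifferentiableAt 𝓘(ℝ, N.model) 𝓘(ℝ, L.model) g (f x))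
    (hf : MDifferentiableAt 𝓘(ℝ, M.model) 𝓘(ℝ, N.model) f x) :
    pullback (g ∘ f) w x = pullback f (pullback g w) x := by
  have h := mfderiv_comp x hg hf
  unfold pullback
  rw [h]
  rfl

lemma pullback_comp {f : M → N} {g : N → L} (w : RawForm L k) (hg : IsSmooth g)
    (hf : IsSmooth f) : pullback (g ∘ f) w = pullback f (pullback g w) :=
  funext fun x => pullback_comp_apply w (IsSmoothAt.mdiff (hg (f x))) (IsSmoothAt.mdiff (hf x))

lemma pullback_id_apply (w : RawForm M k) (x : M) : pullback id w x = w x := by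
  unfold pullback
  rw [mfderiv_id]
  rfl

lemma pullback_congr_form {f : M → N} {w w' : RawForm N k} {x : M} (h : w (f x) = w' (f x)) :
    pullback f w x = pullback f w' x := by
  unfold pullback; rw [h]

lemma pullback_add (f : M → N) (w w' : RawForm N k) :
    pullback f (w + w') = pullback f w + pullback f w' := rfl

lemma pullback_sub (f : M → N) (w w' : RawForm N k) :
    pullback f (w - w') = pullback f w - pullback f w' := rfl

lemma pullback_smul (f : M → N) (c : ℝ) (w : RawForm N k) :
    pullback f (c • w) = c • pullback f w := rfl

/-- The pullback as a linear map. -/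
def pullbackLin (f : M → N) : RawForm N k →ₗ[ℝ] RawForm M k where
  toFun := pullback f
  map_add' := pullback_add f
  map_smul' := pullback_smul f

lemma pullback_sum (f : M → N) {ι : Type*} (s : Finset ι) (w : ι → RawForm N k) :
    pullback f (∑ i ∈ s, w i) = ∑ i ∈ s, pullback f (w i) :=
  map_sum (pullbackLin f) w s

/-- Smoothness of a form at a point, in the preferred chart there. -/
def SmoothAt (w : RawForm M k) (x : M) : Prop :=
  ContDiffAt ℝ ∞ (w.inChart x) (extChartAt 𝓘(ℝ, M.model) x x)

/-- Near `v`, the pullback of `w` along a map `g` from the model space is the pullback of a chart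
expression of `w` along the chart expression of `g`. -/
lemma pullback_eventuallyEq_inChart {E : Type u} [NormedAddCommGroup E] [NormedSpace ℝ E]
    [CompleteSpace E] (w : RawForm M k) {g : ofModel E → M} {v : E}
    (hg : IsSmoothAt g v) :
    (onModel (pullback g w)) =ᶠ[𝓝 v] fun y =>
      (w.inChart (g v) (chart M (g v) (g y))).compContinuousLinearMap
        (fderiv ℝ (fun y => chart M (g v) (g y)) y : E →L[ℝ] M.model) := by
  have hsrc : ∀ᶠ y in 𝓝 v, g y ∈ (extChartAt 𝓘(ℝ, M.model) (g v)).source :=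
    hg.continuousAt (extChartAt_source_mem_nhds (g v))
  filter_upwards [hsrc.eventually_nhds, hg.eventually_mdiff] with y hy hgy
  have hy' := hy.self_of_nhds
  have h1 : pullback g w y = pullback (chartInv M (g v) ∘ (chart M (g v) ∘ g)) w y := by
    refine pullback_congr w ?_
    filter_upwards [hy] with z hz
    exact ((extChartAt 𝓘(ℝ, M.model) (g v)).left_inv hz).symm
  have h2 : MDifferentiableAt 𝓘(ℝ, E) 𝓘(ℝ, M.model) (chart M (g v) ∘ g) y :=
    MDifferentiableAt.comp (I' := 𝓘(ℝ, M.model)) y (isSmoothAt_chart hy').mdiff hgy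
  change pullback g w y = _
  rw [h1, pullback_comp_apply w
    (f := chart M (g v) ∘ g)
    (isSmoothAt_chartInv ((extChartAt 𝓘(ℝ, M.model) (g v)).map_source hy')).mdiff h2]
  change (w.inChart _ _).compContinuousLinearMap (mfderiv _ _ _ _) = _
  rw [mfderiv_eq_fderiv]
  rfl

lemma SmoothAt.contDiffAt_pullback {E : Type u} [NormedAddCommGroup E] [NormedSpace ℝ E]
    [CompleteSpace E] {w : RawForm M k} {g : ofModel E → M} {v : E}
    (hg : IsSmoothAt g v) (hw : w.SmoothAt (g v)) :
    ContDiffAt ℝ ∞ (onModel (pullback g w)) v := by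
  refine ContDiffAt.congr_of_eventuallyEq ?_ (pullback_eventuallyEq_inChart w hg)
  have h : ContDiffAt ℝ ∞ (fun y => chart M (g v) (g y) : E → M.model) v :=
    contMDiffAt_iff_contDiffAt.1
      (ContMDiffAt.comp (I' := 𝓘(ℝ, M.model)) v
        (isSmoothAt_chart (mem_extChartAt_source (g v))) hg)
  exact ContDiffAt.compContinuousLinearMap (ContDiffAt.comp (g := w.inChart (g v)) v hw h)
    (h.fderiv_right (by simp))

/-- The exterior derivative does not depend on the chart in which it is computed. -/
lemma extDeriv_pullback_apply {E : Type u} [NormedAddCommGroup E] [NormedSpace ℝ E]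
    [CompleteSpace E] {w : RawForm M k} {g : ofModel E → M} {v : E}
    (hg : IsSmoothAt g v) (hw : w.SmoothAt (g v)) :
    extDeriv (onModel (pullback g w)) v = pullback g w.d v := by
  rw [(pullback_eventuallyEq_inChart w hg).extDeriv_eq]
  have h : ContDiffAt ℝ ∞ (fun y => chart M (g v) (g y) : E → M.model) v :=
    contMDiffAt_iff_contDiffAt.1
      (ContMDiffAt.comp (I' := 𝓘(ℝ, M.model)) v
        (isSmoothAt_chart (mem_extChartAt_source (g v))) hg)
  have h' := extDeriv_pullback (r := ∞) (f := fun y : E => (chart M (g v) (g y) : M.model))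
    (hw.differentiableAt (by simp)) h
    (by simp; exact WithTop.coe_le_coe.2 (le_top : (2 : ℕ∞) ≤ ⊤))
  rw [h', ← mfderiv_eq_fderiv]
  have := mfderiv_comp (I' := 𝓘(ℝ, M.model)) v
    (isSmoothAt_chart (mem_extChartAt_source (g v))).mdiff hg.mdiff
  have key : ∀ A : M.model [⋀^Fin (k + 1)]→L[ℝ] ℝ, ∀ B B' : E →L[ℝ] M.model, B = B' →
      A.compContinuousLinearMap B = A.compContinuousLinearMap B' := by
    rintro A B _ rfl; rfl
  refine (key (extDeriv (w.inChart (g v)) (chart M (g v) (g v))) _ _ this).trans ?_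
  rfl

/-- Smoothness in the preferred chart at `x`, on its whole domain, only needs smoothness at each
point in the preferred chart of that point. -/
lemma smooth_iff_smoothAt {w : RawForm M k} : w.Smooth ↔ ∀ x, w.SmoothAt x := by
  refine ⟨fun h x => (h x).contDiffAt ((isOpen_extChartAt_target x).mem_nhds
    (mem_extChartAt_target x)), fun h x v hv => ContDiffAt.contDiffWithinAt ?_⟩
  exact SmoothAt.contDiffAt_pullback (isSmoothAt_chartInv hv) (h _)

lemma inChart_pullback_eventuallyEq {f : M → N} {x : M} (hf : IsSmoothAt f x) (w : RawForm N k) :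
    (pullback f w).inChart x =ᶠ[𝓝 (extChartAt 𝓘(ℝ, M.model) x x)]
      pullback (f ∘ chartInv M x) w := by
  have h1 := (continuousAt_extChartAt_symm (I := 𝓘(ℝ, M.model)) x).eventually
    (by rw [extChartAt_to_inv]; exact hf.eventually_mdiff)
  filter_upwards [h1, extChartAt_target_mem_nhds (I := 𝓘(ℝ, M.model)) x] with v hv hvt
  exact (pullback_comp_apply w hv (isSmoothAt_chartInv hvt).mdiff).symm

lemma isSmoothAt_comp_chartInv {f : M → N} {x : M} (hf : IsSmoothAt f x) :
    IsSmoothAt (f ∘ chartInv M x) (extChartAt 𝓘(ℝ, M.model) x x) := by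
  refine ContMDiffAt.comp (I' := 𝓘(ℝ, M.model)) _ ?_ (isSmoothAt_chartInv (mem_extChartAt_target x))
  rw [chartInv_chart]; exact hf

lemma SmoothAt.pullback {f : M → N} {x : M} {w : RawForm N k} (hf : IsSmoothAt f x)
    (hw : w.SmoothAt (f x)) : (pullback f w).SmoothAt x := by
  refine ContDiffAt.congr_of_eventuallyEq ?_ (inChart_pullback_eventuallyEq hf w)
  refine SmoothAt.contDiffAt_pullback (isSmoothAt_comp_chartInv hf) ?_
  change w.SmoothAt (f _)
  rw [chartInv_chart]; exact hw

/-- The exterior derivative is natural. -/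
lemma d_pullback_apply {f : M → N} {x : M} {w : RawForm N k} (hf : IsSmoothAt f x)
    (hw : w.SmoothAt (f x)) : (RawForm.pullback f w).d x = RawForm.pullback f w.d x := by
  have hs : w.SmoothAt ((f ∘ chartInv M x) (extChartAt 𝓘(ℝ, M.model) x x)) := by
    change w.SmoothAt (f _)
    rw [chartInv_chart]; exact hw
  unfold RawForm.d
  rw [(inChart_pullback_eventuallyEq hf w).extDeriv_eq,
    extDeriv_pullback_apply (isSmoothAt_comp_chartInv hf) hs]
  change RawForm.pullback (chart M x) (RawForm.pullback (f ∘ chartInv M x) w.d) x =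
    RawForm.pullback f w.d x
  rw [← pullback_comp_apply _ (isSmoothAt_comp_chartInv hf).mdiff
    (isSmoothAt_chart (mem_extChartAt_source x)).mdiff]
  refine pullback_congr _ ?_
  filter_upwards [extChartAt_source_mem_nhds (I := 𝓘(ℝ, M.model)) x] with y hy
  exact congrArg f ((extChartAt 𝓘(ℝ, M.model) x).left_inv hy)

lemma d_pullback {f : M → N} {w : RawForm N k} (hf : IsSmooth f) (hw : w.Smooth) :
    (RawForm.pullback f w).d = RawForm.pullback f w.d :=
  funext fun x => d_pullback_apply (hf x) (smooth_iff_smoothAt.1 hw _)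

lemma Smooth.pullback {f : M → N} {w : RawForm N k} (hf : IsSmooth f) (hw : w.Smooth) :
    (RawForm.pullback f w).Smooth :=
  smooth_iff_smoothAt.2 fun x => SmoothAt.pullback (hf x) (smooth_iff_smoothAt.1 hw _)

/-- In a chart, the exterior derivative is computed by the exterior derivative of the chart
expression, at every point of the chart domain. -/
lemma inChart_d_eventuallyEq {w : RawForm M k} (hw : w.Smooth) (x : M) :
    w.d.inChart x =ᶠ[𝓝 (extChartAt 𝓘(ℝ, M.model) x x)] extDeriv (w.inChart x) := by
  filter_upwards [extChartAt_target_mem_nhds (I := 𝓘(ℝ, M.model)) x] with v hv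
  exact (extDeriv_pullback_apply (isSmoothAt_chartInv hv) (smooth_iff_smoothAt.1 hw _)).symm

lemma Smooth.d {w : RawForm M k} (hw : w.Smooth) : w.d.Smooth := by
  refine smooth_iff_smoothAt.2 fun x => ?_
  exact ContDiffAt.congr_of_eventuallyEq (ContDiffAt.extDeriv (smooth_iff_smoothAt.1 hw x))
    (inChart_d_eventuallyEq hw x)

lemma d_d {w : RawForm M k} (hw : w.Smooth) : w.d.d = 0 := by
  funext x
  have h : extDeriv (w.d.inChart x) (extChartAt 𝓘(ℝ, M.model) x x) = 0 := by
    rw [(inChart_d_eventuallyEq hw x).extDeriv_eq]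
    exact extDeriv_extDeriv_apply (r := ∞) (smooth_iff_smoothAt.1 hw x)
      (by simp; exact WithTop.coe_le_coe.2 (le_top : (2 : ℕ∞) ≤ ⊤))
  unfold RawForm.d at h ⊢
  rw [h]
  rfl

lemma inChart_congr {w w' : RawForm M k} {x : M} (h : ∀ᶠ y in 𝓝 x, w y = w' y) :
    w.inChart x =ᶠ[𝓝 (extChartAt 𝓘(ℝ, M.model) x x)] w'.inChart x := by
  have h1 := (continuousAt_extChartAt_symm (I := 𝓘(ℝ, M.model)) x).eventually
    (by rw [extChartAt_to_inv]; exact h)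
  filter_upwards [h1] with v hv
  exact pullback_congr_form (f := chartInv M x) hv

lemma SmoothAt.congr {w w' : RawForm M k} {x : M} (hw : w'.SmoothAt x)
    (h : ∀ᶠ y in 𝓝 x, w y = w' y) : w.SmoothAt x :=
  ContDiffAt.congr_of_eventuallyEq hw (inChart_congr h)

lemma Smooth.add {w w' : RawForm M k} (hw : w.Smooth) (hw' : w'.Smooth) : (w + w').Smooth :=
  (smoothForms M k).add_mem hw hw'

lemma Smooth.sub {w w' : RawForm M k} (hw : w.Smooth) (hw' : w'.Smooth) : (w - w').Smooth :=
  (smoothForms M k).sub_mem hw hw'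

lemma d_add {w w' : RawForm M k} (hw : w.Smooth) (hw' : w'.Smooth) : (w + w').d = w.d + w'.d := by
  funext x
  have := extDeriv_add (Smooth.differentiableAt hw x) (Smooth.differentiableAt hw' x)
  unfold RawForm.d
  rw [inChart_add, this]
  rfl

lemma d_sub {w w' : RawForm M k} (hw : w.Smooth) (hw' : w'.Smooth) : (w - w').d = w.d - w'.d := by
  rw [eq_sub_iff_add_eq, ← d_add (hw.sub hw') hw', sub_add_cancel]

lemma SmoothAt.add {w w' : RawForm M k} {x : M} (hw : w.SmoothAt x) (hw' : w'.SmoothAt x) :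
    (w + w').SmoothAt x := by
  unfold SmoothAt at *
  rw [inChart_add]
  exact ContDiffAt.add hw hw'

lemma SmoothAt.zero (x : M) : (0 : RawForm M k).SmoothAt x :=
  smooth_iff_smoothAt.1 (smoothForms M k).zero_mem x

lemma SmoothAt.sum {ι : Type*} {s : Finset ι} {w : ι → RawForm M k} {x : M}
    (h : ∀ i ∈ s, (w i).SmoothAt x) : (∑ i ∈ s, w i).SmoothAt x := by
  classical
  induction s using Finset.induction_on with
  | empty => simpa using SmoothAt.zero x
  | insert i s hi ih =>
    rw [Finset.sum_insert hi]
    exact (h i (by simp)).add (ih fun j hj => h j (by simp [hj]))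

lemma SmoothAt.smul_fun {ρ : M → ℝ} {w : RawForm M k} {x : M}
    (hρ : ContMDiffAt 𝓘(ℝ, M.model) 𝓘(ℝ, ℝ) ∞ ρ x) (hw : w.SmoothAt x) :
    RawForm.SmoothAt (fun y => ρ y • w y : RawForm M k) x := by
  have h : ContDiffAt ℝ ∞ (fun v : M.model => ρ (chartInv M x v))
      (extChartAt 𝓘(ℝ, M.model) x x) := by
    refine contMDiffAt_iff_contDiffAt.1 (ContMDiffAt.comp (I' := 𝓘(ℝ, M.model)) (g := ρ) _ ?_
      (isSmoothAt_chartInv (mem_extChartAt_target x)))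
    rw [chartInv_chart]; exact hρ
  exact ContDiffAt.smul h hw

end RawForm

/-! ### Local sections and descent of forms -/

section LocalSections

variable {W B : SmoothMfd.{u}} {k : ℕ}

/-- `s` is a smooth section of `p` over the open set `U`. Its values outside `U` are irrelevant. -/
structure IsLocalSection (p : W → B) (U : Set B) (s : B → W) : Prop where
  isOpen : IsOpen U
  smooth : IsSmoothOn s U
  right_inv : ∀ b ∈ U, p (s b) = b

/-- A smooth map that has a local section near every point of its target. -/
structure HasLocalSections (p : W → B) : Prop where
  smooth : IsSmooth p
  exists_section : ∀ b, ∃ U s, b ∈ U ∧ IsLocalSection p U s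

variable {p : W → B} {U : Set B} {s : B → W}

lemma IsLocalSection.smoothAt (hs : IsLocalSection p U s) {b : B} (hb : b ∈ U) : IsSmoothAt s b :=
  ContMDiffOn.contMDiffAt hs.smooth (hs.isOpen.mem_nhds hb)

lemma IsLocalSection.pullback_pullback (hs : IsLocalSection p U s) (hp : IsSmooth p) {b : B}
    (hb : b ∈ U) (w : RawForm B k) : pullback s (pullback p w) b = w b := by
  rw [← pullback_comp_apply w (IsSmoothAt.mdiff (hp _)) (hs.smoothAt hb).mdiff,
    ← pullback_id_apply w b]
  refine pullback_congr w ?_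
  filter_upwards [hs.isOpen.mem_nhds hb] with c hc using hs.right_inv c hc

lemma HasLocalSections.pullback_injective (hp : HasLocalSections p) {w w' : RawForm B k}
    (h : pullback p w = pullback p w') : w = w' := by
  funext b
  obtain ⟨U, s, hb, hs⟩ := hp.exists_section b
  rw [← hs.pullback_pullback hp.smooth hb w, h, hs.pullback_pullback hp.smooth hb w']

/-- A form on `W` descends to `B` as soon as it is not changed by moving points along the fibres
onto a local section. -/
lemma HasLocalSections.exists_pullback_eq (hp : HasLocalSections p) {w : RawForm W k}
    (hw : w.Smooth)
    (h : ∀ U s, IsLocalSection p U s → ∀ x, p x ∈ U → pullback (s ∘ p) w x = w x) :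
    ∃ v : RawForm B k, v.Smooth ∧ pullback p v = w := by
  choose U s hb hs using hp.exists_section
  -- the value at `b` is computed with a section near `b` that varies with `b`
  let v : RawForm B k := fun b => pullback (s b) w b
  have hv : pullback p v = w := by
    funext x
    have h1 : pullback p v x = pullback p (pullback (s (p x)) w) x := pullback_congr_form rfl
    rw [h1, ← pullback_comp_apply w ((hs (p x)).smoothAt (hb _)).mdiff
      (IsSmoothAt.mdiff (hp.smooth x)), h _ _ (hs (p x)) x (hb _)]
  refine ⟨v, smooth_iff_smoothAt.2 fun b => ?_, hv⟩
  refine SmoothAt.congr (SmoothAt.pullback ((hs b).smoothAt (hb b)) (smooth_iff_smoothAt.1 hw _)) ?_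
  filter_upwards [(hs b).isOpen.mem_nhds (hb b)] with c hc
  rw [← (hs b).pullback_pullback hp.smooth hc v, hv]

/-- In charts in which a submersion is a linear projection, it has sections that are constant in
the complementary directions. -/
lemma SmoothMfd.IsSurjSubmersion.hasLocalSections (hp : IsSurjSubmersion p) :
    HasLocalSections p := by
  refine ⟨fun x => (hp.submersion x).contMDiffAt, fun b => ?_⟩
  obtain ⟨x, rfl⟩ := hp.surjective b
  obtain ⟨F, _, _, h⟩ := hp.submersion x
  set φ := h.domChart
  set ψ := h.codChart
  set e := h.equiv
  let c : W.model := φ x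
  let t : B.model → W.model := fun v => e.symm (v, (e c).2)
  have ht : ContDiff ℝ ∞ t := e.symm.contDiff.comp (contDiff_id.prodMk contDiff_const)
  have hloc : ∀ u ∈ φ.target, ψ (p (φ.symm u)) = (e u).1 := fun u hu => by
    have hu' : u ∈ (h.domChart.extend 𝓘(ℝ, W.model)).target := by simpa using hu
    simpa using h.writtenInCharts hu'
  have hx : ψ (p x) = (e c).1 := by
    have := hloc (φ x) (φ.map_source h.mem_domChart_source)
    rwa [φ.left_inv h.mem_domChart_source] at this
  have hU : IsOpen (ψ.source ∩ ψ ⁻¹' (t ⁻¹' φ.target)) :=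
    ψ.isOpen_inter_preimage (φ.open_target.preimage ht.continuous)
  refine ⟨ψ.source ∩ ψ ⁻¹' (t ⁻¹' φ.target), fun b => φ.symm (t (ψ b)),
    ⟨h.mem_codChart_source, ?_⟩, ⟨hU, ?_, ?_⟩⟩
  · have : t (ψ (p x)) = c := by simp [t, hx]
    change t (ψ (p x)) ∈ φ.target
    rw [this]
    exact φ.map_source h.mem_domChart_source
  · have h1 := contMDiffOn_symm_of_mem_maximalAtlas h.domChart_mem_maximalAtlas
    have h2 := contMDiffOn_of_mem_maximalAtlas h.codChart_mem_maximalAtlas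
    refine h1.comp (t := φ.target) ?_ fun b hb => hb.2
    exact ht.contMDiff.comp_contMDiffOn (h2.mono Set.inter_subset_left)
  · intro b hb
    have h1 := hloc _ hb.2
    have h2 : p (φ.symm (t (ψ b))) ∈ ψ.source :=
      h.source_subset_preimage_source (φ.map_target hb.2)
    refine ψ.injOn h2 hb.1 ?_
    rw [h1]
    simp [t]

end LocalSections

/-! ### Alternating sums of pullbacks -/

section Delta

variable {M N L K : SmoothMfd.{u}} {k n : ℕ}

lemma RawForm.sum_apply {ι : Type*} (s : Finset ι) (w : ι → RawForm M k) (x : M) :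
    (∑ i ∈ s, w i) x = ∑ i ∈ s, w i x :=
  Finset.sum_apply x s w

lemma delta_apply (q : Fin n → M → N) (w : RawForm N k) (x : M) :
    delta q w x = ∑ i : Fin n, (-1 : ℝ) ^ (i : ℕ) • pullback (q i) w x := by
  unfold delta
  exact Finset.sum_apply x _ _

/-- `delta` as a linear map. -/
def deltaLin (q : Fin n → M → N) : RawForm N k →ₗ[ℝ] RawForm M k :=
  ∑ i : Fin n, (-1 : ℝ) ^ (i : ℕ) • pullbackLin (q i)

lemma deltaLin_apply (q : Fin n → M → N) (w : RawForm N k) : deltaLin q w = delta q w := by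
  simp only [deltaLin, LinearMap.sum_apply]
  rfl

lemma delta_add (q : Fin n → M → N) (w w' : RawForm N k) :
    delta q (w + w') = delta q w + delta q w' := by
  simp only [← deltaLin_apply, map_add]

lemma delta_sub (q : Fin n → M → N) (w w' : RawForm N k) :
    delta q (w - w') = delta q w - delta q w' := by
  simp only [← deltaLin_apply, map_sub]

lemma RawForm.Smooth.delta {q : Fin n → M → N} (hq : ∀ i, IsSmooth (q i)) {w : RawForm N k}
    (hw : w.Smooth) : (delta q w).Smooth :=
  (smoothForms M k).sum_mem fun i _ => (smoothForms M k).smul_mem _ (hw.pullback (hq i))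

lemma RawForm.d_sum_smul {ι : Type*} (s : Finset ι) (c : ι → ℝ) (w : ι → RawForm M k)
    (hw : ∀ i, (w i).Smooth) : (∑ i ∈ s, c i • w i).d = ∑ i ∈ s, c i • (w i).d := by
  have h := map_sum (dLin M k) (fun i => c i • (⟨w i, hw i⟩ : smoothForms M k)) s
  simp only [map_smul] at h
  have h2 : ((∑ i ∈ s, c i • (⟨w i, hw i⟩ : smoothForms M k) : smoothForms M k) : RawForm M k) =
      ∑ i ∈ s, c i • w i := by
    simp
  change RawForm.d ((∑ i ∈ s, c i • (⟨w i, hw i⟩ : smoothForms M k) : smoothForms M k) :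
    RawForm M k) = ∑ i ∈ s, c i • (w i).d at h
  rwa [h2] at h

lemma RawForm.d_delta {q : Fin n → M → N} (hq : ∀ i, IsSmooth (q i)) {w : RawForm N k}
    (hw : w.Smooth) : (_root_.delta q w).d = _root_.delta q w.d := by
  unfold _root_.delta
  rw [d_sum_smul _ _ _ fun i => hw.pullback (hq i)]
  exact Finset.sum_congr rfl fun i _ => by rw [d_pullback (hq i) hw]

lemma pullback_delta {q : Fin n → M → N} {q' : Fin n → L → K} {g : L → M} {g' : K → N}
    (hq : ∀ i, IsSmooth (q i)) (hq' : ∀ i, IsSmooth (q' i)) (hg : IsSmooth g) (hg' : IsSmooth g')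
    (h : ∀ i x, q i (g x) = g' (q' i x)) (w : RawForm N k) :
    pullback g (delta q w) = delta q' (pullback g' w) := by
  unfold delta
  rw [pullback_sum]
  refine Finset.sum_congr rfl fun i _ => ?_
  rw [pullback_smul, ← pullback_comp w (hq i) hg, ← pullback_comp w hg' (hq' i)]
  congr 2
  exact funext (h i)

/-- Two commuting families of face maps have commuting alternating sums. -/
lemma delta_comm {m : ℕ} {p : Fin n → M → N} {q : Fin m → L → M} {p' : Fin n → L → K}
    {q' : Fin m → K → N} (hp : ∀ i, IsSmooth (p i)) (hq : ∀ i, IsSmooth (q i))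
    (hp' : ∀ i, IsSmooth (p' i)) (hq' : ∀ i, IsSmooth (q' i))
    (h : ∀ i j x, p i (q j x) = q' j (p' i x)) (w : RawForm N k) :
    delta q (delta p w) = delta p' (delta q' w) := by
  have h1 : ∀ j, pullback (q j) (delta p w) = delta p' (pullback (q' j) w) := fun j =>
    pullback_delta hp hp' (hq j) (hq' j) (fun i x => h i j x) w
  unfold delta at h1 ⊢
  simp only [h1, pullback_sum, Finset.smul_sum, pullback_smul]
  rw [Finset.sum_comm]
  exact Finset.sum_congr rfl fun i _ => Finset.sum_congr rfl fun j _ => smul_comm _ _ _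

/-- The alternating sums of two consecutive families of simplicial face maps compose to zero. -/
lemma delta_delta {p : Fin (n + 1) → M → N} {q : Fin (n + 2) → L → M}
    (hp : ∀ i, IsSmooth (p i)) (hq : ∀ i, IsSmooth (q i))
    (h : ∀ i j : Fin (n + 1), i ≤ j → ∀ x, p j (q i.castSucc x) = p i (q j.succ x))
    (w : RawForm N k) : delta q (delta p w) = 0 := by
  have h1 : delta q (delta p w) = ∑ a : Fin (n + 2) × Fin (n + 1),
      ((-1 : ℝ) ^ (a.1 : ℕ) * (-1 : ℝ) ^ (a.2 : ℕ)) • pullback (p a.2 ∘ q a.1) w := by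
    rw [Fintype.sum_prod_type]
    unfold delta
    refine Finset.sum_congr rfl fun i _ => ?_
    rw [pullback_sum, Finset.smul_sum]
    refine Finset.sum_congr rfl fun j _ => ?_
    rw [pullback_smul, smul_smul, pullback_comp w (hp j) (hq i)]
  rw [h1]
  let S : Finset (Fin (n + 2) × Fin (n + 1)) := {a | (a.1 : ℕ) ≤ a.2}
  rw [← Finset.sum_add_sum_compl S, ← eq_neg_iff_add_eq_zero, ← Finset.sum_neg_distrib]
  -- the terms `(i, j)` with `i ≤ j` cancel against the terms `(j + 1, i)`
  refine Finset.sum_bij' (fun a ha => (a.2.succ, a.1.castLT ?_))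
    (fun a ha => (a.2.castSucc, a.1.pred ?_)) ?_ ?_ ?_ ?_ ?_
  · simp only [S, Finset.mem_filter_univ] at ha
    omega
  · simp only [S, Finset.mem_compl, Finset.mem_filter_univ] at ha
    rintro h0
    rw [h0] at ha
    simp at ha
  · rintro ⟨i, j⟩ ha
    simp only [S, Finset.mem_filter_univ, Finset.mem_compl] at ha ⊢
    simp
    omega
  · rintro ⟨i, j⟩ ha
    simp only [S, Finset.mem_filter_univ, Finset.mem_compl] at ha ⊢
    simp
    omega
  · rintro ⟨i, j⟩ ha
    simp
  · rintro ⟨i, j⟩ ha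
    simp
  · rintro ⟨i, j⟩ ha
    simp only [S, Finset.mem_filter_univ] at ha
    have hi : (i : ℕ) < n + 1 := by omega
    have h2 : p j ∘ q i = p (i.castLT hi) ∘ q j.succ := by
      funext x
      exact h (i.castLT hi) j ha x
    simp only [h2, Fin.val_succ, Fin.val_castLT, ← neg_smul]
    congr 1
    ring

end Delta

/-! ### Partitions of unity -/

section Partition

/-- Every cover of `B` by open neighbourhoods of its points has a subordinate smooth partition of
unity. -/
def AdmitsPartitions (B : SmoothMfd.{u}) : Prop :=
  ∀ U : B → Set B, (∀ b, IsOpen (U b)) → (∀ b, b ∈ U b) → ∃ ρ : B → B → ℝ,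
    (∀ i, ContMDiff 𝓘(ℝ, B.model) 𝓘(ℝ, ℝ) ∞ (ρ i)) ∧
    LocallyFinite (fun i => Function.support (ρ i)) ∧
    (∀ i, tsupport (ρ i) ⊆ U i) ∧ ∀ b, ∑ᶠ i, ρ i b = 1

/-- A closed subspace of a finite-dimensional second countable manifold inherits partitions of
unity, whatever the smooth structure on it, as long as the inclusion is smooth. -/
lemma AdmitsPartitions.of_isClosedEmbedding {B : SmoothMfd.{u}} {E H T : Type*}
    [NormedAddCommGroup E] [NormedSpace ℝ E] [FiniteDimensional ℝ E] [TopologicalSpace H]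
    {I : ModelWithCorners ℝ E H} [TopologicalSpace T] [ChartedSpace H T] [IsManifold I ∞ T]
    [T2Space T] [SecondCountableTopology T] {j : B → T} (hj : IsClosedEmbedding j)
    (hs : ContMDiff 𝓘(ℝ, B.model) I ∞ j) : AdmitsPartitions B := by
  intro U hU hb
  have := I.locallyCompactSpace
  have := ChartedSpace.locallyCompactSpace H T
  choose V hV hVU using fun b => hj.isInducing.isOpen_iff.1 (hU b)
  obtain ⟨ρ, hρ⟩ := SmoothPartitionOfUnity.exists_isSubordinate I hj.isClosed_range V hV
    (by
      rintro _ ⟨b, rfl⟩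
      refine Set.mem_iUnion.2 ⟨b, ?_⟩
      have : b ∈ j ⁻¹' V b := by rw [hVU]; exact hb b
      exact this)
  refine ⟨fun i b => ρ i (j b), fun i => (ρ i).contMDiff.comp hs, ?_, fun i => ?_, fun b => ?_⟩
  · exact ρ.locallyFinite.preimage_continuous hj.continuous
  · rw [← hVU i]
    refine (closure_minimal ?_ ((isClosed_tsupport (ρ i)).preimage hj.continuous)).trans
      (Set.preimage_mono (hρ i))
    exact fun b hb => subset_tsupport (ρ i) hb
  · exact ρ.sum_eq_one ⟨b, rfl⟩

lemma SmoothMfd.IsFiniteDim.admitsPartitions {B : SmoothMfd.{u}} (hB : B.IsFiniteDim) :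
    AdmitsPartitions B := by
  have := hB.finiteDimensional
  have := hB.secondCountable
  exact .of_isClosedEmbedding (j := id) .id contMDiff_id

/-- The two-fold fibre product of `f : M → N` is closed in `M × M`. -/
lemma FibrePowerStr.admitsPartitions {M N : SmoothMfd.{u}} (hM : M.IsFiniteDim) {f : M → N}
    (hf : Continuous f) (P : FibrePowerStr f 2) : AdmitsPartitions P.mfd := by
  have := hM.finiteDimensional
  have := hM.secondCountable
  refine .of_isClosedEmbedding (I := 𝓘(ℝ, M.model).prod 𝓘(ℝ, M.model))
    (j := fun y : P.mfd => (y.1 0, y.1 1)) ?_ ((P.smooth_proj 0).prodMk (P.smooth_proj 1))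
  -- this uses that `N` is Hausdorff
  have h1 : IsClosed {y : Fin 2 → M | ∀ i j, f (y i) = f (y j)} := by
    simp only [Set.ofPred_forall]
    exact isClosed_iInter fun i => isClosed_iInter fun j => isClosed_eq
      (hf.comp (continuous_apply i)) (hf.comp (continuous_apply j))
  exact (Homeomorph.finTwoArrow (X := M)).isClosedEmbedding.comp h1.isClosedEmbedding_subtypeVal

end Partition

/-! ### The contracting homotopy -/

section Homotopy

variable {A B C D : SmoothMfd.{u}} {k n : ℕ}

/-- A partition of unity glues local extra degeneracies: if, over small open sets of the base, the
face maps `q` and `r` admit extra degeneracies `hA` and `hC`, then the kernel of `delta r` is the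
image of `delta q`. -/
lemma exists_delta_eq (hB : AdmitsPartitions B) {pA : A → B} {pC : C → B} (hpA : IsSmooth pA)
    (hpC : Continuous pC) {q : Fin (n + 1) → C → A} {r : Fin (n + 2) → D → C}
    (hq : ∀ j, IsSmooth (q j)) (hr : ∀ j, IsSmooth (r j)) (hpq : ∀ j c, pA (q j c) = pC c)
    (h : ∀ b : B, ∃ (U : Set B) (hA : A → C) (hC : C → D), IsOpen U ∧ b ∈ U ∧
      IsSmoothOn hA (pA ⁻¹' U) ∧ IsSmoothOn hC (pC ⁻¹' U) ∧
      (∀ c, pC c ∈ U → r 0 (hC c) = c) ∧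
      ∀ c j, pC c ∈ U → r (Fin.succ j) (hC c) = hA (q j c))
    {w : RawForm C k} (hw : w.Smooth) (hdw : delta r w = 0) :
    ∃ v : RawForm A k, v.Smooth ∧ delta q v = w := by
  choose U hA hC hU hb hAs hCs hr0 hrs using h
  obtain ⟨ρ, hρs, hρf, hρU, hρ1⟩ := hB U hU hb
  have hAat : ∀ i x, pA x ∈ U i → IsSmoothAt (hA i) x := fun i x hx =>
    ContMDiffOn.contMDiffAt (hAs i) (((hU i).preimage hpA.continuous).mem_nhds hx)
  have hCat : ∀ i x, pC x ∈ U i → IsSmoothAt (hC i) x := fun i x hx =>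
    ContMDiffOn.contMDiffAt (hCs i) (((hU i).preimage hpC).mem_nhds hx)
  -- the primitive is the sum of the `ρ i • (hA i)^* w`; where `hA i` is not controlled, `ρ i` is `0`
  let t : B → RawForm A k := fun i x => ρ i (pA x) • pullback (hA i) w x
  let v : RawForm A k := fun x => ∑ᶠ i, t i x
  have hv : ∀ (I : Finset B) (x : A), (∀ i, ρ i (pA x) ≠ 0 → i ∈ I) → v x = ∑ i ∈ I, t i x := by
    intro I x hI
    refine finsum_eq_sum_of_support_subset _ fun i hi => hI i fun h0 => hi ?_
    simp only [t, h0, zero_smul]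
  refine ⟨v, smooth_iff_smoothAt.2 fun x => ?_, funext fun c => ?_⟩
  · obtain ⟨V, hV, hfin⟩ := hρf (pA x)
    refine SmoothAt.congr (w' := ∑ i ∈ hfin.toFinset, t i) (SmoothAt.sum fun i _ => ?_) ?_
    · by_cases hx : pA x ∈ tsupport (ρ i)
      · have hx' := hρU i hx
        exact SmoothAt.smul_fun (((hρs i) _).comp x (hpA x))
          (SmoothAt.pullback (hAat i x hx') (smooth_iff_smoothAt.1 hw _))
      · refine SmoothAt.congr (SmoothAt.zero x) ?_
        have h0 : ∀ᶠ b in 𝓝 (pA x), ρ i b = 0 := notMem_tsupport_iff_eventuallyEq.1 hx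
        filter_upwards [hpA.continuous.continuousAt.eventually h0] with y hy
        simp only [t, hy, zero_smul]
        rfl
    · filter_upwards [hpA.continuous.continuousAt hV] with y hy
      rw [hv hfin.toFinset y fun i hi => hfin.mem_toFinset.2 ⟨_, hi, hy⟩]
      exact (RawForm.sum_apply _ _ y).symm
  · have hfin := hρf.point_finite (pC c)
    set I := hfin.toFinset with hI
    have hmem : ∀ i, i ∈ I ↔ ρ i (pC c) ≠ 0 := fun i => hfin.mem_toFinset
    have hIU : ∀ i ∈ I, pC c ∈ U i := fun i hi =>
      hρU i (subset_tsupport _ ((hmem i).1 hi))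
    have hI1 : ∑ i ∈ I, ρ i (pC c) = 1 := by
      rw [← hρ1 (pC c)]
      exact (finsum_eq_sum_of_support_subset _ fun i hi => (hmem i).2 hi).symm
    -- `hA i ∘ q j = r (j + 1) ∘ hC i` over `U i`
    have h1 : ∀ j, pullback (q j) v c =
        ∑ i ∈ I, ρ i (pC c) • pullback (hC i) (pullback (r j.succ) w) c := by
      intro j
      have e1 : pullback (q j) v c =
          pullback (q j) (∑ i ∈ I, ρ i (pC c) • pullback (hA i) w) c := by
        refine pullback_congr_form ?_
        rw [hv I (q j c) fun i hi => (hmem i).2 (by rwa [hpq] at hi)]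
        rw [RawForm.sum_apply]
        exact Finset.sum_congr rfl fun i _ => by simp only [t, hpq]; rfl
      rw [e1, pullback_sum, RawForm.sum_apply]
      refine Finset.sum_congr rfl fun i hi => ?_
      rw [pullback_smul]
      change ρ i (pC c) • pullback (q j) (pullback (hA i) w) c = _
      have hAq : pA (q j c) ∈ U i := by rw [hpq]; exact hIU i hi
      rw [← pullback_comp_apply w (hAat i _ hAq).mdiff (IsSmoothAt.mdiff (hq j c)),
        ← pullback_comp_apply w (IsSmoothAt.mdiff (hr _ _)) (hCat i c (hIU i hi)).mdiff]
      congr 1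
      refine pullback_congr w ?_
      filter_upwards [((hU i).preimage hpC).mem_nhds (hIU i hi)] with c' hc'
      exact (hrs i c' j hc').symm
    -- `delta r w = 0` expresses the remaining terms by the one of `r 0`, and `r 0 ∘ hC i = id`
    have h2 : ∀ i ∈ I,
        ∑ j : Fin (n + 1), (-1 : ℝ) ^ (j : ℕ) •
          pullback (hC i) (pullback (r (Fin.succ j)) w) c = w c := by
      intro i hi
      have h0 : pullback (hC i) (pullback (r 0) w) c = w c := by
        rw [← pullback_comp_apply w (IsSmoothAt.mdiff (hr _ _)) (hCat i c (hIU i hi)).mdiff,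
          ← pullback_id_apply w c]
        refine pullback_congr w ?_
        filter_upwards [((hU i).preimage hpC).mem_nhds (hIU i hi)] with c' hc' using hr0 i c' hc'
      have h3 : pullback (hC i) (delta r w) c = 0 := by rw [hdw]; rfl
      unfold delta at h3
      rw [pullback_sum, RawForm.sum_apply, Fin.sum_univ_succ] at h3
      have h5 : w c - ∑ j : Fin (n + 1), (-1 : ℝ) ^ (j : ℕ) •
          pullback (hC i) (pullback (r (Fin.succ j)) w) c = 0 := by
        rw [← h3, ← h0, sub_eq_add_neg, ← Finset.sum_neg_distrib]
        congr 1
        · simp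
        · refine Finset.sum_congr rfl fun j _ => ?_
          rw [pullback_smul, Fin.val_succ, pow_succ, mul_neg_one, neg_smul]
          rfl
      exact (sub_eq_zero.1 h5).symm
    rw [delta_apply]
    simp only [h1, Finset.smul_sum]
    rw [Finset.sum_comm]
    calc _ = ∑ i ∈ I, ρ i (pC c) • w c := by
          refine Finset.sum_congr rfl fun i hi => ?_
          rw [← h2 i hi, Finset.smul_sum]
          exact Finset.sum_congr rfl fun j _ => smul_comm _ _ _
      _ = w c := by rw [← Finset.sum_smul, hI1, one_smul]

end Homotopy

/-! ### Exactness for fibre powers of submersions -/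

section FibrePowers

variable {M N : SmoothMfd.{u}} {f : M → N} {k n m : ℕ}

/-- The extra degeneracy of the fibre powers of `f` that a section `s` of `f` defines: it adds the
point `s (f y)` in front. It has a junk value where `s` fails to be a section. -/
def consSection (s : N → M) (y : FibrePower f (n + 1)) : FibrePower f (n + 2) :=
  open Classical in
  if h : f (s (f (y.1 0))) = f (y.1 0) then
    ⟨Fin.cons (s (f (y.1 0))) y.1, fun i j => by
      have key : ∀ i, f ((Fin.cons (s (f (y.1 0))) y.1 : Fin (n + 2) → M) i) = f (y.1 0) := by
        intro i
        cases i using Fin.cases with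
        | zero => simpa using h
        | succ i => simpa using y.2 i 0
      rw [key, key]⟩
  else ⟨fun _ => y.1 0, fun _ _ => rfl⟩

lemma consSection_val {s : N → M} {U : Set N} (hs : IsLocalSection f U s)
    {y : FibrePower f (n + 1)} (hy : f (y.1 0) ∈ U) :
    (consSection s y).1 = Fin.cons (s (f (y.1 0))) y.1 := by
  rw [consSection, dif_pos (hs.right_inv _ hy)]

lemma dropFace_zero_consSection {s : N → M} {U : Set N} (hs : IsLocalSection f U s)
    {y : FibrePower f (n + 1)} (hy : f (y.1 0) ∈ U) : dropFace 0 (consSection s y) = y := by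
  refine Subtype.ext (funext fun i => ?_)
  simp [dropFace, consSection_val hs hy]

lemma dropFace_succ_consSection {s : N → M} {U : Set N} (hs : IsLocalSection f U s)
    {y : FibrePower f (n + 2)} (hy : f (y.1 0) ∈ U) (j : Fin (n + 2)) :
    dropFace j.succ (consSection s y) = consSection s (dropFace j y) := by
  have h0 : f ((dropFace j y).1 0) = f (y.1 0) := y.2 _ _
  refine Subtype.ext (funext fun i => ?_)
  rw [consSection_val hs (by rwa [h0]), h0]
  simp only [dropFace, consSection_val hs hy]
  cases i using Fin.cases with
  | zero => simp
  | succ i => simp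

/-- A point as an element of the one-fold fibre product. -/
def FibrePower.single (f : M → N) (x : M) : FibrePower f 1 := ⟨fun _ => x, fun _ _ => rfl⟩

namespace FibrePowerStr

lemma smooth_dropFace (P : FibrePowerStr f (n + 1)) (Q : FibrePowerStr f n) (i : Fin (n + 1)) :
    IsSmooth (M := P.mfd) (N := Q.mfd) (dropFace i) := by
  rw [IsSmooth, ← contMDiffOn_univ]
  exact Q.smooth_of_components P.mfd _ _ isOpen_univ fun j => (P.smooth_proj _).contMDiffOn

lemma smooth_dropFace₂ (P : FibrePowerStr f 2) (i : Fin 2) :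
    IsSmooth (M := P.mfd) (N := M) (dropFace₂ i) :=
  P.smooth_proj _

lemma smooth_map {M' N' : SmoothMfd.{u}} {f' : M' → N'} (P : FibrePowerStr f n)
    (Q : FibrePowerStr f' n) {g : M → M'} {h : N → N'} (comm : ∀ y, f' (g y) = h (f y))
    (hg : IsSmooth g) : IsSmooth (M := P.mfd) (N := Q.mfd) (FibrePower.map g h comm) := by
  rw [IsSmooth, ← contMDiffOn_univ]
  exact Q.smooth_of_components P.mfd _ _ isOpen_univ fun j =>
    (hg.comp (P.smooth_proj j)).contMDiffOn

/-- If `g : L → M^{[n+1]}` has smooth components, prepending a local section is smooth. -/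
lemma smoothOn_consSection {L : SmoothMfd.{u}} (Q : FibrePowerStr f (n + 2)) (hf : IsSmooth f)
    {s : N → M} {U : Set N} (hs : IsLocalSection f U s) {g : L → FibrePower f (n + 1)}
    (hg : ∀ i, IsSmooth fun x => (g x).1 i) :
    IsSmoothOn (M := L) (N := Q.mfd) (fun x => consSection s (g x))
      {x | f ((g x).1 0) ∈ U} := by
  have hc : IsSmooth fun x => f ((g x).1 0) := hf.comp (hg 0)
  refine Q.smooth_of_components L _ _ (hs.isOpen.preimage hc.continuous) fun i => ?_
  cases i using Fin.cases with
  | zero =>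
    refine (hs.smooth.comp (hc.contMDiffOn (s := {x | f ((g x).1 0) ∈ U})) fun x hx => hx).congr
      fun x hx => ?_
    simp [consSection_val hs hx]
  | succ i =>
    refine (hg i).contMDiffOn.congr fun x hx => ?_
    simp [consSection_val hs hx]

/-- The two pullbacks to the second fibre power of a form on the base agree. -/
lemma delta_dropFace₂_pullback (P₂ : FibrePowerStr f 2) (hf : IsSmooth f) (v : RawForm N k) :
    delta (M := P₂.mfd) dropFace₂ (pullback f v) = 0 := by
  have h : ∀ i, pullback (M := P₂.mfd) (dropFace₂ i) (pullback f v) =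
      pullback (M := P₂.mfd) (fun y => f (y.1 0)) v := by
    intro i
    rw [← pullback_comp v hf (smooth_dropFace₂ P₂ i)]
    congr 1
    exact funext fun y => y.2 _ _
  simp [delta, Fin.sum_univ_two, h]


/-- Exactness at the second fibre power. -/
lemma exists_delta_dropFace₂_eq (hf : HasLocalSections f) (hN : AdmitsPartitions N)
    (P₂ : FibrePowerStr f 2) (P₃ : FibrePowerStr f 3) {w : RawForm P₂.mfd k} (hw : w.Smooth)
    (hdw : delta (M := P₃.mfd) (N := P₂.mfd) dropFace w = 0) :
    ∃ v : RawForm M k, v.Smooth ∧ delta (M := P₂.mfd) dropFace₂ v = w := by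
  refine exists_delta_eq hN (A := M) (C := P₂.mfd) (D := P₃.mfd) (pA := f)
    (pC := fun y => f (y.1 0)) hf.smooth
    (hf.smooth.continuous.comp (P₂.smooth_proj 0).continuous) (smooth_dropFace₂ P₂)
    (smooth_dropFace P₃ P₂) (fun j y => y.2 _ _) (fun b => ?_) hw hdw
  obtain ⟨U, s, hb, hs⟩ := hf.exists_section b
  refine ⟨U, fun x => consSection s (FibrePower.single f x), consSection s, hs.isOpen, hb,
    smoothOn_consSection P₂ hf.smooth hs fun i => contMDiff_id,
    smoothOn_consSection (L := P₂.mfd) P₃ hf.smooth hs (g := id) fun i => P₂.smooth_proj i,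
    fun y hy => dropFace_zero_consSection hs hy, fun y j hy => ?_⟩
  rw [dropFace_succ_consSection hs hy]
  congr 1
  refine Subtype.ext (funext fun i => ?_)
  cases i using Fin.cases with
  | zero => rfl
  | succ i => exact i.elim0

/-- Exactness at the higher fibre powers. -/
lemma exists_delta_dropFace_eq (hf : HasLocalSections f) (hN : AdmitsPartitions N)
    (P₁ : FibrePowerStr f (n + 1)) (P₂ : FibrePowerStr f (n + 2)) (P₃ : FibrePowerStr f (n + 3))
    {w : RawForm P₂.mfd k} (hw : w.Smooth) (hdw : delta (M := P₃.mfd) (N := P₂.mfd) dropFace w = 0) :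
    ∃ v : RawForm P₁.mfd k, v.Smooth ∧ delta (M := P₂.mfd) (N := P₁.mfd) dropFace v = w := by
  have hp := fun (j : ℕ) (P : FibrePowerStr f (j + 1)) =>
    (hf.smooth.comp (P.smooth_proj 0) : IsSmooth (M := P.mfd) fun y => f (y.1 0))
  refine exists_delta_eq hN (A := P₁.mfd) (C := P₂.mfd) (D := P₃.mfd)
    (pA := fun y => f (y.1 0)) (pC := fun y => f (y.1 0)) (hp _ P₁) (hp _ P₂).continuous
    (smooth_dropFace P₂ P₁) (smooth_dropFace P₃ P₂) (fun j y => y.2 _ _) (fun b => ?_) hw hdw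
  obtain ⟨U, s, hb, hs⟩ := hf.exists_section b
  exact ⟨U, consSection s, consSection s, hs.isOpen, hb,
    smoothOn_consSection (L := P₁.mfd) P₂ hf.smooth hs (g := id) fun i => P₁.smooth_proj i,
    smoothOn_consSection (L := P₂.mfd) P₃ hf.smooth hs (g := id) fun i => P₂.smooth_proj i,
    fun y hy => dropFace_zero_consSection hs hy,
    fun y j hy => dropFace_succ_consSection hs hy j⟩

/-- Exactness at the total space: a form whose two pullbacks to the second fibre power agree
descends to the base. -/
lemma exists_pullback_eq (hf : HasLocalSections f) (P₂ : FibrePowerStr f 2) {w : RawForm M k}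
    (hw : w.Smooth)
    (hdw : delta (M := P₂.mfd) dropFace₂ w = 0) :
    ∃ v : RawForm N k, v.Smooth ∧ pullback f v = w := by
  refine hf.exists_pullback_eq hw fun U s hs x hx => ?_
  let h : M → P₂.mfd := fun y => consSection s (FibrePower.single f y)
  have hU : IsOpen (f ⁻¹' U) := hs.isOpen.preimage hf.smooth.continuous
  have hh : IsSmoothAt h x := ContMDiffOn.contMDiffAt
    (smoothOn_consSection P₂ hf.smooth hs (g := FibrePower.single f) fun i => contMDiff_id)
    (hU.mem_nhds hx)
  have h0 : pullback (M := P₂.mfd) (dropFace₂ 0) w = pullback (M := P₂.mfd) (dropFace₂ 1) w := by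
    simpa [delta, Fin.sum_univ_two, ← sub_eq_add_neg, sub_eq_zero] using hdw
  have h1 : pullback (dropFace₂ 0 ∘ h) w x = pullback (dropFace₂ 1 ∘ h) w x := by
    rw [pullback_comp_apply (N := P₂.mfd) w (IsSmoothAt.mdiff (smooth_dropFace₂ P₂ 0 _)) hh.mdiff,
      pullback_comp_apply (N := P₂.mfd) w (IsSmoothAt.mdiff (smooth_dropFace₂ P₂ 1 _)) hh.mdiff]
    exact congrFun (congrArg (pullback h) h0) x
  rw [← pullback_id_apply w x]
  refine Eq.trans ?_ (h1.symm.trans ?_)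
  · refine pullback_congr w ?_
    filter_upwards [hU.mem_nhds hx] with y hy
    have : (h y).1 = _ := consSection_val hs (y := FibrePower.single f y) hy
    simp [dropFace₂, this, FibrePower.single]
  · refine pullback_congr w ?_
    filter_upwards [hU.mem_nhds hx] with y hy
    have : (h y).1 = _ := consSection_val hs (y := FibrePower.single f y) hy
    simp only [dropFace₂, this, FibrePower.single, Function.comp]
    rfl

end FibrePowerStr

end FibrePowers

/-! ### The difference of two connections on a circle bundle -/

section CircleBundles

variable {B C L : SmoothMfd.{u}} (E : CircleBundle B)

namespace CircleBundle

lemma smooth_proj : IsSmooth E.proj := by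
  intro e
  obtain ⟨t, hb, ht, -, -⟩ := E.locally_trivial (E.proj e)
  have he : e ∈ t.source := by rw [t.source_eq]; exact hb
  have h1 := (ht.contMDiffAt (t.open_source.mem_nhds he)).fst
  refine h1.congr_of_eventuallyEq ?_
  filter_upwards [t.open_source.mem_nhds he] with e' he'
  exact (t.proj_toFun e' he').symm

lemma hasLocalSections_proj : HasLocalSections E.proj := by
  refine ⟨E.smooth_proj, fun b => ?_⟩
  obtain ⟨t, hb, -, ht, -⟩ := E.locally_trivial b
  have hmem : ∀ c ∈ t.baseSet, (c, (1 : Circle)) ∈ t.target := fun c hc => by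
    rw [t.target_eq]; exact ⟨hc, trivial⟩
  refine ⟨t.baseSet, fun c => t.toOpenPartialHomeomorph.symm (c, 1), hb, t.open_baseSet, ?_, ?_⟩
  · exact ht.comp (contMDiff_id.prodMk contMDiff_const).contMDiffOn hmem
  · exact fun c hc => t.proj_symm_apply (hmem c hc)

/-- The action of `U(1)`, composed with the exponential map, is smooth. -/
lemma smooth_exp_smul : ContMDiff (𝓘(ℝ, ℝ).prod 𝓘(ℝ, E.total.model)) 𝓘(ℝ, E.total.model) ∞
    fun a : ℝ × E.total => Circle.exp a.1 • a.2 := by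
  rintro ⟨r, e⟩
  obtain ⟨t, hb, ht, hts, hsm⟩ := E.locally_trivial (E.proj e)
  have hsrc : ∀ e', e' ∈ t.source ↔ E.proj e' ∈ t.baseSet := fun e' => by rw [t.source_eq]; rfl
  let G : ℝ × E.total → B × Circle := fun a => (E.proj a.2, Circle.exp a.1 * (t a.2).2)
  have hU : IsOpen {a : ℝ × E.total | a.2 ∈ t.source} := t.open_source.preimage continuous_snd
  have he : e ∈ t.source := (hsrc e).2 hb
  have hG : ContMDiffAt (𝓘(ℝ, ℝ).prod 𝓘(ℝ, E.total.model)) (𝓘(ℝ, B.model).prod (𝓡 1)) ∞ G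
      (r, e) := by
    refine ContMDiffAt.prodMk ((E.smooth_proj e).comp _ contMDiffAt_snd) ?_
    refine ContMDiffAt.mul (ContMDiffAt.comp (r, e) (I' := 𝓘(ℝ, ℝ))
      (contMDiff_circleExp (r : ℝ)) contMDiffAt_fst) ?_
    have h2 : ContMDiffAt 𝓘(ℝ, E.total.model) (𝓡 1) ∞ (fun e' => (t e').2) e :=
      (ht.contMDiffAt (t.open_source.mem_nhds he)).snd
    exact ContMDiffAt.comp (g := fun e' => (t e').2) (f := Prod.snd) (r, e) h2 contMDiffAt_snd
  have hmem : G (r, e) ∈ t.target := by rw [t.target_eq]; exact ⟨hb, trivial⟩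
  have h1 := (hts.contMDiffAt (t.open_target.mem_nhds hmem)).comp (r, e) hG
  refine h1.congr_of_eventuallyEq ?_
  filter_upwards [hU.mem_nhds he] with a ha
  have ha' : a.2 ∈ t.source := ha
  have h2 : Circle.exp a.1 • a.2 ∈ t.source := by
    rw [hsrc, E.proj_smul]; exact (hsrc _).1 ha'
  have h3 : t (Circle.exp a.1 • a.2) = G a := by
    rw [hsm _ _ ha']
    exact Prod.ext (t.proj_toFun _ ha') rfl
  change _ = t.toOpenPartialHomeomorph.symm (G a)
  rw [← h3]
  exact (t.left_inv h2).symm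

lemma smooth_smul (z : Circle) : IsSmooth fun e : E.total => z • e := by
  have h := E.smooth_exp_smul.comp (contMDiff_const (c := Complex.arg z) |>.prodMk contMDiff_id)
  have h2 : (fun e : E.total => z • e) =
      (fun a : ℝ × E.total => Circle.exp a.1 • a.2) ∘ fun e => (Complex.arg z, id e) := by
    funext e
    simp [Circle.exp_arg]
  rw [h2]
  exact h

/-- A smooth 1-form on the total space is basic if it is invariant and vanishes on the generator of
the action of `U(1)`. -/
structure IsBasic (D : RawForm E.total 1) : Prop where
  smooth : D.Smooth
  invariant : ∀ z : Circle, pullback (fun e : E.total => z • e) D = D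
  vertical : ∀ e : E.total, (show E.total.model [⋀^Fin 1]→L[ℝ] ℝ from D e) (fun _ =>
    mfderiv 𝓘(ℝ, ℝ) 𝓘(ℝ, E.total.model) (fun t : ℝ => Circle.exp t • e) 0 (1 : ℝ)) = 0

variable {E}

lemma IsConnection.isBasic_sub {A A' : RawForm E.total 1} (hA : E.IsConnection A)
    (hA' : E.IsConnection A') : E.IsBasic (A' - A) := by
  refine ⟨hA'.smooth.sub hA.smooth, fun z => ?_, fun e => ?_⟩
  · rw [pullback_sub, hA.invariant, hA'.invariant]
  · have key : ∀ A : RawForm E.total 1, E.IsConnection A →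
        (show E.total.model [⋀^Fin 1]→L[ℝ] ℝ from A e) (fun _ =>
          mfderiv 𝓘(ℝ, ℝ) 𝓘(ℝ, E.total.model) (fun t : ℝ => Circle.exp t • e) 0 (1 : ℝ)) = 1 := by
      intro A hA
      let φ : E.total → E.total.model [⋀^Fin 1]→L[ℝ] ℝ := A
      have h1 : φ (Circle.exp 0 • e) (fun _ =>
          mfderiv 𝓘(ℝ, ℝ) 𝓘(ℝ, E.total.model) (fun t : ℝ => Circle.exp t • e) 0 (1 : ℝ)) = 1 :=
        hA.vertical e
      have h2 : Circle.exp 0 • e = e := by simp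
      rw [congrArg φ h2] at h1
      exact h1
    have h : ∀ P Q : E.total.model [⋀^Fin 1]→L[ℝ] ℝ, ∀ v, Q v = 1 → P v = 1 → (Q - P) v = 0 := by
      intro P Q v h1 h2
      rw [ContinuousAlternatingMap.sub_apply, h1, h2, sub_self]
    exact h _ _ _ (key A' hA') (key A hA)

/-- Moving a map along the fibres by a smooth function does not change the pullback of a basic
form. -/
lemma IsBasic.pullback_exp_smul {D : RawForm E.total 1} (hD : E.IsBasic D) {θ : L → ℝ}
    {σ : L → E.total} {x : L} (hθ : MDifferentiableAt 𝓘(ℝ, L.model) 𝓘(ℝ, ℝ) θ x) (h0 : θ x = 0)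
    (hσ : MDifferentiableAt 𝓘(ℝ, L.model) 𝓘(ℝ, E.total.model) σ x) :
    pullback (fun y => Circle.exp (θ y) • σ y) D x = pullback σ D x := by
  let Ψ : ℝ × E.total → E.total := fun a => Circle.exp a.1 • a.2
  let G : L → ℝ × E.total := fun y => (θ y, σ y)
  have hΨ : MDifferentiableAt (𝓘(ℝ, ℝ).prod 𝓘(ℝ, E.total.model)) 𝓘(ℝ, E.total.model) Ψ (G x) :=
    (E.smooth_exp_smul (G x)).mdifferentiableAt (by simp)
  have hG : MDifferentiableAt 𝓘(ℝ, L.model) (𝓘(ℝ, ℝ).prod 𝓘(ℝ, E.total.model)) G x :=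
    hθ.prodMk hσ
  let dθ : L.model →L[ℝ] ℝ := mfderiv 𝓘(ℝ, L.model) 𝓘(ℝ, ℝ) θ x
  let dσ : L.model →L[ℝ] E.total.model := mfderiv 𝓘(ℝ, L.model) 𝓘(ℝ, E.total.model) σ x
  let orb : ℝ → ℝ →L[ℝ] E.total.model := fun r =>
    mfderiv 𝓘(ℝ, ℝ) 𝓘(ℝ, E.total.model) (fun t : ℝ => Circle.exp t • σ x) r
  let act : ℝ → E.total.model →L[ℝ] E.total.model := fun r =>
    mfderiv 𝓘(ℝ, E.total.model) 𝓘(ℝ, E.total.model) (fun e : E.total => Circle.exp r • e) (σ x)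
  let dΨG : L.model →L[ℝ] E.total.model :=
    mfderiv 𝓘(ℝ, L.model) 𝓘(ℝ, E.total.model) (Ψ ∘ G) x
  have hact : act 0 = ContinuousLinearMap.id ℝ _ := by
    have h1 : (fun e : E.total => Circle.exp 0 • e) = id := by funext e; simp
    have h2 : mfderiv 𝓘(ℝ, E.total.model) 𝓘(ℝ, E.total.model) (id : E.total → E.total) (σ x) =
      ContinuousLinearMap.id ℝ _ := mfderiv_id
    have key : ∀ f : E.total → E.total, f = id →
        (mfderiv 𝓘(ℝ, E.total.model) 𝓘(ℝ, E.total.model) f (σ x) :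
          E.total.model →L[ℝ] E.total.model) = ContinuousLinearMap.id ℝ _ := by
      rintro _ rfl; exact h2
    exact key _ h1
  have hd : ∀ v, dΨG v = dθ v • orb 0 1 + dσ v := by
    intro v
    have h1 : dΨG v = orb (θ x) (dθ v) + act (θ x) (dσ v) := by
      have e1 := mfderiv_comp x hΨ hG
      have e2 := mfderiv_prod_eq_add_apply (p := G x)
        (v := mfderiv 𝓘(ℝ, L.model) (𝓘(ℝ, ℝ).prod 𝓘(ℝ, E.total.model)) G x v) hΨ
      have e3 : mfderiv 𝓘(ℝ, L.model) (𝓘(ℝ, ℝ).prod 𝓘(ℝ, E.total.model)) G x =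
        dθ.prod dσ := hθ.mfderiv_prod hσ
      have e4 : dΨG v = _ := (DFunLike.congr_fun e1 v).trans e2
      rw [e3] at e4
      exact e4
    rw [h1, h0, hact]
    have h2 : orb 0 (dθ v) = dθ v • orb 0 1 := by rw [← map_smul, smul_eq_mul, mul_one]
    rw [h2]
    rfl
  let φ : E.total → E.total.model [⋀^Fin 1]→L[ℝ] ℝ := D
  have hlin : ∀ (P : E.total.model [⋀^Fin 1]→L[ℝ] ℝ) (c : ℝ) (a b : E.total.model),
      P (fun _ => a) = 0 → P (fun _ => c • a + b) = P (fun _ => b) := by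
    intro P c a b hP
    have hu : ∀ a, Function.update (fun _ : Fin 1 => (0 : E.total.model)) 0 a = fun _ => a := by
      intro a; funext i; rw [Subsingleton.elim i 0, Function.update_self]
    have h1 := P.map_update_add (fun _ => 0) 0 (c • a) b
    have h2 := P.map_update_smul (fun _ => 0) 0 c a
    rw [hu, hu, hu] at h1
    rw [hu, hu, hP, smul_zero] at h2
    rw [h1, h2, zero_add]
  have hx : Ψ (G x) = σ x := by simp [Ψ, G, h0]
  have hfin : (φ (Ψ (G x))).compContinuousLinearMap dΨG = (φ (σ x)).compContinuousLinearMap dσ := by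
    rw [hx]
    ext v
    have hv : ∀ T : L.model →L[ℝ] E.total.model, (T ∘ v) = fun _ => T (v 0) := by
      intro T; funext i; rw [Subsingleton.elim i 0]; rfl
    rw [ContinuousAlternatingMap.compContinuousLinearMap_apply,
      ContinuousAlternatingMap.compContinuousLinearMap_apply, hv, hv, hd]
    exact hlin _ _ _ _ (hD.vertical (σ x))
  exact hfin

/-- Two points of a fibre differ by a unique element of `U(1)`, which depends smoothly on them.
Hence a basic form does not change under moving points along the fibres. -/
lemma IsBasic.pullback_apply {D : RawForm E.total 1} (hD : E.IsBasic D) {σ : E.total → E.total}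
    {e : E.total} (hσ : IsSmoothAt σ e) (hp : ∀ᶠ e' in 𝓝 e, E.proj (σ e') = E.proj e') :
    pullback σ D e = D e := by
  obtain ⟨t, hb, ht, -, hsm⟩ := E.locally_trivial (E.proj e)
  have hsrc : ∀ e', e' ∈ t.source ↔ E.proj e' ∈ t.baseSet := fun e' => by rw [t.source_eq]; rfl
  have he : e ∈ t.source := (hsrc e).2 hb
  have hσe : σ e ∈ t.source := by rw [hsrc, hp.self_of_nhds]; exact hb
  -- the element of `U(1)` that moves a point to its image under `σ`
  let z : E.total → Circle := fun e' => (t (σ e')).2 * (t e').2⁻¹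
  have hz : ContMDiffAt 𝓘(ℝ, E.total.model) (𝓡 1) ∞ z e := by
    have h1 : ContMDiffAt 𝓘(ℝ, E.total.model) (𝓡 1) ∞ (fun e' => (t e').2) e :=
      (ht.contMDiffAt (t.open_source.mem_nhds he)).snd
    have h2 : ContMDiffAt 𝓘(ℝ, E.total.model) (𝓡 1) ∞ (fun e' => (t e').2) (σ e) :=
      (ht.contMDiffAt (t.open_source.mem_nhds hσe)).snd
    exact (ContMDiffAt.comp e h2 hσ).mul h1.inv
  let y : E.total → Circle := fun e' => z e' * (z e)⁻¹
  have hy : ContMDiffAt 𝓘(ℝ, E.total.model) (𝓡 1) ∞ y e := hz.mul contMDiffAt_const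
  have hye : y e = 1 := mul_inv_cancel _
  let θ : E.total → ℝ := fun e' => Complex.arg (y e')
  have hθ : ContMDiffAt 𝓘(ℝ, E.total.model) 𝓘(ℝ, ℝ) ∞ θ e := by
    have hc : ContMDiff (𝓡 1) 𝓘(ℝ, ℂ) ∞ fun w : Circle => (w : ℂ) :=
      haveI := finrank_real_complex_fact'
      contMDiff_coe_sphere (E := ℂ)
    have h1 : ContMDiffAt 𝓘(ℝ, E.total.model) 𝓘(ℝ, ℂ) ∞ (fun e' => (y e' : ℂ)) e :=
      ContMDiffAt.comp (I' := 𝓡 1) e hc.contMDiffAt hy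
    have h2 : ContDiffAt ℝ ∞ Complex.arg (y e : ℂ) := by
      have h3 : ContDiffAt ℝ ∞ Complex.log (y e : ℂ) := by
        refine (Complex.contDiffAt_log ?_).restrict_scalars ℝ
        rw [hye]; simp
      have h4 := Complex.imCLM.contDiff.contDiffAt.comp _ h3
      exact h4.congr_of_eventuallyEq (Filter.Eventually.of_forall fun w => (Complex.log_im w).symm)
    exact ContMDiffAt.comp (I' := 𝓘(ℝ, ℂ)) e h2.contMDiffAt h1
  have h0 : θ e = 0 := by simp [θ, hye]
  have hm := E.smooth_smul (z e)
  have heq : σ =ᶠ[𝓝 e] fun e' => Circle.exp (θ e') • (z e • e') := by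
    filter_upwards [hp, t.open_source.mem_nhds he] with e' hpe he'
    have h1 : σ e' ∈ t.source := by rw [hsrc, hpe]; exact (hsrc _).1 he'
    have h2 : ∀ w : Circle, w • e' ∈ t.source := fun w => by
      rw [hsrc, E.proj_smul]; exact (hsrc _).1 he'
    have h3 : Circle.exp (θ e') = y e' := Circle.exp_arg _
    rw [h3, smul_smul]
    refine t.injOn h1 (h2 _) ?_
    refine Eq.trans ?_ (hsm _ _ he').symm
    refine Prod.ext ?_ ?_
    · exact (t.proj_toFun _ h1).trans (hpe.trans (t.proj_toFun _ he').symm)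
    · change (t (σ e')).2 = z e' * (z e)⁻¹ * z e * (t e').2
      rw [inv_mul_cancel_right, inv_mul_cancel_right]
  rw [pullback_congr D heq, hD.pullback_exp_smul (hθ.mdifferentiableAt (by simp)) h0
    (IsSmoothAt.mdiff (hm e)), hD.invariant]

lemma IsBasic.exists_pullback_eq {D : RawForm E.total 1} (hD : E.IsBasic D) :
    ∃ a : RawForm B 1, a.Smooth ∧ pullback E.proj a = D := by
  refine E.hasLocalSections_proj.exists_pullback_eq hD.smooth fun U s hs e he => ?_
  refine hD.pullback_apply (ContMDiffAt.comp e (hs.smoothAt he) (E.smooth_proj e)) ?_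
  filter_upwards [(hs.isOpen.preimage E.smooth_proj.continuous).mem_nhds he] with e' he'
  exact hs.right_inv _ he'

/-- If two connections differ by the pullback of a form `a` on the base, then the forms that they
induce along a section `s` of `δE` differ by `δa`. -/
lemma IsPullbackConnection.sub_eq_delta {n : ℕ} {p : Fin n → C → B}
    {s : C → Set (Fin n → E.total)} (hs : E.IsSection p sign₁ s) {A A' : RawForm E.total 1}
    {η η' : RawForm C 1} (h : E.IsPullbackConnection p s A η)
    (h' : E.IsPullbackConnection p s A' η') {a : RawForm B 1} (ha : pullback E.proj a = A' - A) :
    η' - η = delta p a := by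
  funext c
  obtain ⟨U, σ, hc, hσ⟩ := hs c
  have e1 : (η' - η) c = delta σ (A' - A) c := by
    rw [delta_sub]
    change η' c - η c = delta σ A' c - delta σ A c
    rw [h U σ hσ c hc, h' U σ hσ c hc]
  rw [e1, ← ha, delta_apply, delta_apply]
  refine Finset.sum_congr rfl fun i _ => ?_
  have hi : IsSmoothAt (σ i) c := ContMDiffOn.contMDiffAt (hσ.smooth i) (hσ.isOpen.mem_nhds hc)
  rw [← pullback_comp_apply a (IsSmoothAt.mdiff (E.smooth_proj _)) hi.mdiff]
  congr 1
  refine pullback_congr a ?_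
  filter_upwards [hσ.isOpen.mem_nhds hc] with c' hc' using hσ.lies_over c' hc' i

/-- The curvatures of two connections that differ by a form `a` on the base differ by `da`. -/
lemma IsCurvature.sub_eq_d {A A' : RawForm E.total 1} {F F' : RawForm B 2} (hA : A.Smooth)
    (hA' : A'.Smooth) (h : E.IsCurvature A F) (h' : E.IsCurvature A' F') {a : RawForm B 1}
    (has : a.Smooth) (ha : pullback E.proj a = A' - A) : F' - F = a.d := by
  refine E.hasLocalSections_proj.pullback_injective ?_
  rw [pullback_sub, h.2, h'.2, ← d_pullback E.smooth_proj has, ha, d_sub hA' hA]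

end CircleBundle

end CircleBundles

/-! ### Face maps of rigid bundle 2-gerbes -/

namespace RigidSubmersion

variable {X : SmoothMfd.{u}} (S : RigidSubmersion X)

lemma smooth_face (k : Fin 3) (i : Fin (k + 2)) : IsSmooth (S.face k i) :=
  Hom.isSmooth (S.Z.map _)

lemma smooth_πm (k : Fin 4) : IsSmooth (S.πm k) := Hom.isSmooth (S.π.app _)

lemma hasLocalSections_πm (k : Fin 4) : HasLocalSections (S.πm k) :=
  (S.π_submersion (.op (simplex k))).hasLocalSections

lemma smooth_faceH (k : Fin 3) (n : ℕ) (i : Fin (k + 2)) : IsSmooth (S.faceH k n i) :=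
  FibrePowerStr.smooth_map _ _ _ (S.smooth_face k i)

lemma πm_face (k : Fin 3) (i : Fin (k + 2)) (z : S.Zm k.succ) :
    S.πm k.castSucc (S.face k i z) = dropFace i (S.πm k.succ z) :=
  S.face_comm k i z

/-- The relations between the face maps of the simplicial manifold `Z`. -/
lemma face_face (i j : Fin 3) (h : i ≤ j) (z : S.Zm 3) :
    S.face 1 j (S.face 2 i.castSucc z) = S.face 1 i (S.face 2 j.succ z) := by
  let δ₁ (j : Fin 3) : simplex 1 ⟶ simplex 2 := SimplexCategory.Truncated.Hom.tr
    (SimplexCategory.δ (n := 1) j) (simplex 1).property (simplex 2).property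
  let δ₂ (i : Fin 4) : simplex 2 ⟶ simplex 3 := SimplexCategory.Truncated.Hom.tr
    (SimplexCategory.δ (n := 2) i) (simplex 2).property (simplex 3).property
  have h0 : δ₁ i ≫ δ₂ j.succ = δ₁ j ≫ δ₂ i.castSucc :=
    congrArg (fun g => SimplexCategory.Truncated.Hom.tr g (simplex 1).property
      (simplex 3).property) (SimplexCategory.δ_comp_δ (n := 1) h)
  have h1 : S.Z.map (δ₂ i.castSucc).op ≫ S.Z.map (δ₁ j).op =
      S.Z.map (δ₂ j.succ).op ≫ S.Z.map (δ₁ i).op := by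
    rw [← S.Z.map_comp, ← S.Z.map_comp, ← op_comp, ← op_comp, h0]
  exact congrFun (congrArg Hom.toFun h1) z

end RigidSubmersion

/-! ### Comparison of connective structures -/

namespace ConnectiveStructure

variable {X : SmoothMfd.{u}} {G : RigidBundle2Gerbe X} (C : ConnectiveStructure G)

lemma hasLocalSections_f (G : RigidBundle2Gerbe X) : HasLocalSections G.f :=
  G.f_submersion.hasLocalSections

/-- `δ(dλ) = 0`, because it holds after pulling back to `Z_1`, where `δ(dλ)` becomes `ddβ`. Hence
`dλ` descends to `X`. -/
lemma exists_isFourCurvature : ∃ F, C.IsFourCurvature F := by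
  have hf := hasLocalSections_f G
  have hq : ∀ i, IsSmooth (M := (G.Ypow 1).mfd) (G.faceY i) := FibrePowerStr.smooth_dropFace₂ _
  refine FibrePowerStr.exists_pullback_eq hf (G.Ypow 1) C.lam_smooth.d ?_
  refine (G.hasLocalSections_πm 1).pullback_injective ?_
  change pullback (G.πm 1) (delta G.faceY C.lam.d) = _
  rw [← d_delta hq C.lam_smooth, ← d_pullback (G.smooth_πm 1) (C.lam_smooth.delta hq),
    C.two_curving, d_d C.β_smooth]
  rfl

lemma IsFourCurvature.mem_closedForms {F : RawForm X 4} (hF : C.IsFourCurvature F) :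
    F ∈ closedForms X 4 := by
  have hf := hasLocalSections_f G
  refine ⟨⟨F, hF.1⟩, ?_, rfl⟩
  change F.d = 0
  refine hf.pullback_injective ?_
  rw [← d_pullback hf.smooth hF.1, hF.2, d_d C.lam_smooth]
  rfl

lemma IsFourCurvature.unique {F K : RawForm X 4} (hF : C.IsFourCurvature F)
    (hK : C.IsFourCurvature K) : K = F :=
  (hasLocalSections_f G).pullback_injective (hK.2.trans hF.2.symm)

end ConnectiveStructure

namespace RigidConnectiveStructure

variable {X : SmoothMfd.{u}} {G : RigidBundle2Gerbe X} (C C' : RigidConnectiveStructure G)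

/-- The connections differ by `a = δ_v b`; the fibrewise primitive `b` can be corrected by a form on
`Y^{[2]}` so that it also accounts for the difference of the 1-forms on `Z_2`. The form `a` enters
the statement only through `da`, the difference of the curvatures. -/
lemma exists_primitive (hX : X.IsFiniteDim) : ∃ b : RawForm (G.Zm 1) 1, b.Smooth ∧
    delta (M := G.Zp 1 1) (G.faceV₀ 1) b.d = delta (M := G.Zp 1 1) (G.faceV₀ 1) (C'.β - C.β) ∧
    delta (M := G.Zm 2) (G.face 1) b = C'.α - C.α := by
  have hf := ConnectiveStructure.hasLocalSections_f G
  have hY : AdmitsPartitions (G.Ypow 1).mfd :=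
    FibrePowerStr.admitsPartitions G.Y_finiteDim hf.smooth.continuous (G.Ypow 1)
  have hv₀ : ∀ (k : Fin 4) i, IsSmooth (M := G.Zp k 1) (G.faceV₀ k i) := fun k =>
    FibrePowerStr.smooth_dropFace₂ _
  have hY₂ : ∀ i, IsSmooth (M := (G.Ypow 2).mfd) (N := (G.Ypow 1).mfd) (dropFace i) :=
    FibrePowerStr.smooth_dropFace _ _
  have hY₃ : ∀ i, IsSmooth (M := (G.Ypow 3).mfd) (N := (G.Ypow 2).mfd) (dropFace i) :=
    FibrePowerStr.smooth_dropFace _ _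
  -- the difference of the connections
  obtain ⟨a, ha, haA⟩ := (C.conn_connection.isBasic_sub C'.conn_connection).exists_pullback_eq
  have hda : delta (G.faceV 1 1) a = 0 := by
    rw [← C.conn_gerbe.sub_eq_delta G.m_section C'.conn_gerbe haA, sub_self]
  obtain ⟨b₀, hb₀, hb₀a⟩ := FibrePowerStr.exists_delta_dropFace₂_eq (G.hasLocalSections_πm 1) hY
    (G.Zpow 1 1) (G.Zpow 1 2) ha hda
  have hα : (C'.α - C.α - delta (M := G.Zm 2) (G.face 1) b₀).Smooth :=
    (C'.α_smooth.sub C.α_smooth).sub (hb₀.delta (G.smooth_face 1))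
  have hαv : delta (M := G.Zp 2 1) dropFace₂
      (C'.α - C.α - delta (M := G.Zm 2) (G.face 1) b₀) = 0 := by
    have h1 : delta (M := G.Zp 2 1) (G.faceV₀ 2) (C'.α - C.α) = delta (G.faceH 1 1) a := by
      rw [delta_sub]
      exact C.α_vertical.sub_eq_delta G.mult_section C'.α_vertical haA
    have h2 : delta (M := G.Zp 2 1) (G.faceV₀ 2) (delta (M := G.Zm 2) (G.face 1) b₀) =
        delta (G.faceH 1 1) (delta (M := G.Zp 1 1) (G.faceV₀ 1) b₀) :=
      delta_comm (G.smooth_face 1) (hv₀ 2) (G.smooth_faceH 1 1) (hv₀ 1) (fun i j x => rfl) b₀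
    change delta (M := G.Zp 2 1) (G.faceV₀ 2) _ = 0
    rw [delta_sub, h1, h2, ← hb₀a]
    exact sub_self _
  obtain ⟨ε, hε, hεα⟩ := FibrePowerStr.exists_pullback_eq (G.hasLocalSections_πm 2) (G.Zpow 2 1)
    hα hαv
  have hεd : delta (M := (G.Ypow 3).mfd) (N := (G.Ypow 2).mfd) dropFace ε = 0 := by
    refine (G.hasLocalSections_πm 3).pullback_injective ?_
    have h1 := pullback_delta hY₃ (G.smooth_face 2) (G.smooth_πm 3) (G.smooth_πm 2)
      (fun i z => (G.πm_face 2 i z).symm) ε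
    have h2 : delta (G.face 2) (delta (M := G.Zm 2) (G.face 1) b₀) = 0 :=
      delta_delta (G.smooth_face 1) (G.smooth_face 2) (fun i j hij z => G.face_face i j hij z) b₀
    rw [h1]
    rw [hεα, delta_sub, delta_sub, C.α_horizontal, C'.α_horizontal, h2, sub_zero, sub_zero]
    rfl
  obtain ⟨κ, hκ, hκε⟩ := FibrePowerStr.exists_delta_dropFace_eq hf hX.admitsPartitions
    (G.Ypow 1) (G.Ypow 2) (G.Ypow 3) hε hεd
  have hπκ : (pullback (G.πm 1) κ).Smooth := hκ.pullback (G.smooth_πm 1)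
  refine ⟨b₀ + pullback (G.πm 1) κ, hb₀.add hπκ, ?_, ?_⟩
  · have h1 : delta (M := G.Zp 1 1) (G.faceV₀ 1) (pullback (G.πm 1) κ) = 0 :=
      FibrePowerStr.delta_dropFace₂_pullback (G.Zpow 1 1) (G.smooth_πm 1) κ
    rw [← d_delta (hv₀ 1) (hb₀.add hπκ), delta_add, h1, add_zero, delta_sub]
    have h2 := C.curving.sub_eq_d C.conn_connection.smooth C'.conn_connection.smooth C'.curving
      ha haA
    rw [h2, ← hb₀a]
    rfl
  · have h1 := pullback_delta hY₂ (G.smooth_face 1) (G.smooth_πm 2) (G.smooth_πm 1)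
      (fun i z => (G.πm_face 1 i z).symm) κ
    rw [delta_add, ← h1, hκε]
    rw [hεα]
    abel

/-- The difference of the curvings, corrected by the primitive `b`, comes from `δμ` on `Y^{[2]}`
with `μ` a 2-form on `Y`; the difference of the 2-curvings, corrected by `μ`, comes from `X`. -/
lemma exists_sub_eq_d (hX : X.IsFiniteDim) {F F' : RawForm X 4} (hF : C.IsFourCurvature F)
    (hF' : C'.IsFourCurvature F') : ∃ η : RawForm X 3, η.Smooth ∧ F' - F = η.d := by
  have hf := ConnectiveStructure.hasLocalSections_f G
  have hY₁ : ∀ i, IsSmooth (M := (G.Ypow 1).mfd) (G.faceY i) := FibrePowerStr.smooth_dropFace₂ _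
  have hY₂ : ∀ i, IsSmooth (M := (G.Ypow 2).mfd) (N := (G.Ypow 1).mfd) (dropFace i) :=
    FibrePowerStr.smooth_dropFace _ _
  obtain ⟨b, hb, hbv, hbα⟩ := C.exists_primitive C' hX
  have hβ := C'.β_smooth.sub C.β_smooth
  have hlam := C'.lam_smooth.sub C.lam_smooth
  obtain ⟨γ, hγ, hγβ⟩ := FibrePowerStr.exists_pullback_eq (G.hasLocalSections_πm 1) (G.Zpow 1 1)
    (hβ.sub hb.d) (by rw [delta_sub]; exact sub_eq_zero.2 hbv.symm)
  have hγd : delta (M := (G.Ypow 2).mfd) (N := (G.Ypow 1).mfd) dropFace γ = 0 := by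
    refine (G.hasLocalSections_πm 2).pullback_injective ?_
    have h1 := pullback_delta hY₂ (G.smooth_face 1) (G.smooth_πm 2) (G.smooth_πm 1)
      (fun i z => (G.πm_face 1 i z).symm) γ
    rw [h1]
    rw [hγβ, delta_sub, ← d_delta (G.smooth_face 1) hb, hbα, delta_sub,
      d_sub C'.α_smooth C.α_smooth, C.α_d, C'.α_d, sub_self]
    rfl
  obtain ⟨μ, hμ, hμγ⟩ := FibrePowerStr.exists_delta_dropFace₂_eq hf hX.admitsPartitions
    (G.Ypow 1) (G.Ypow 2) hγ hγd
  obtain ⟨η, hη, hηlam⟩ := FibrePowerStr.exists_pullback_eq hf (G.Ypow 1) (hlam.sub hμ.d) (by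
    refine (G.hasLocalSections_πm 1).pullback_injective ?_
    change pullback (G.πm 1) (delta G.faceY (C'.lam - C.lam - μ.d)) = _
    have h1 : pullback (G.πm 1) γ.d = C'.β.d - C.β.d := by
      rw [← d_pullback (G.smooth_πm 1) hγ]
      rw [hγβ, d_sub hβ hb.d, d_d hb, sub_zero, d_sub C'.β_smooth C.β_smooth]
    have h2 : delta G.faceY μ = γ := hμγ
    rw [delta_sub, delta_sub, pullback_sub, pullback_sub, C.two_curving, C'.two_curving,
      ← d_delta hY₁ hμ, h2, h1, sub_self]
    rfl)
  refine ⟨η, hη, hf.pullback_injective ?_⟩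
  rw [← d_pullback hf.smooth hη, pullback_sub, hF.2, hF'.2]
  change _ = (pullback G.f η).d
  rw [hηlam, d_sub hlam hμ.d, d_d hμ, sub_zero, d_sub C'.lam_smooth C.lam_smooth]

end RigidConnectiveStructure

end

theorem mainTheorem5 {X : SmoothMfd.{u}} (hX : X.IsFiniteDim) (G : RigidBundle2Gerbe X)
    (C C' : RigidConnectiveStructure G) :
    ∃ F F' : RawForm X 4,
      (∀ K, C.IsFourCurvature K ↔ K = F) ∧
      (∀ K, C'.IsFourCurvature K ↔ K = F') ∧
      (∃ η : RawForm X 3, η.Smooth ∧ F - F' = η.d) ∧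
      ∃ (hF : F ∈ closedForms X 4) (hF' : F' ∈ closedForms X 4),
        deRhamClass F hF = deRhamClass F' hF' := by
  obtain ⟨F, hF⟩ := C.exists_isFourCurvature
  obtain ⟨F', hF'⟩ := C'.exists_isFourCurvature
  obtain ⟨η, hη, h⟩ := C'.exists_sub_eq_d C hX hF' hF
  refine ⟨F, F', fun K => ⟨fun hK => ConnectiveStructure.IsFourCurvature.unique _ hF hK, ?_⟩,
    fun K => ⟨fun hK => ConnectiveStructure.IsFourCurvature.unique _ hF' hK, ?_⟩, ⟨η, hη, h⟩,
    ConnectiveStructure.IsFourCurvature.mem_closedForms _ hF,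
    ConnectiveStructure.IsFourCurvature.mem_closedForms _ hF', ?_⟩
  · rintro rfl; exact hF
  · rintro rfl; exact hF'
  · refine (Submodule.Quotient.eq _).2 ?_
    exact ⟨⟨η, hη⟩, h.symm⟩
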